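/- **Theorem 2.1.** Let $\varepsilon>0$ and $\kappa>\frac1{16}+\varepsilon$. For $A>0$ and $t>0$ let $$\mathbb G(t,x-x',y,z-z';y')=\frac1{(2\pi)^3}\int_{\mathbb R^3}e^{i(x\xi+y\eta+z\zeta)}\,e^{-ix'\xi-iy'(\eta+A\xi t)-iz'\zeta}\,e^{\int_0^t[v(s)-\kappa-4v(s)^2]\,ds}\,d\xi\,d\eta\,d\zeta,$$ where $v(s)=\xi^2+(\eta+A\xi s)^2+\zeta^2$. For every $A>0$ this is the Green's function (fundamental solution) of the operator $\partial_t+Ay\,\partial_x+\Delta+4\Delta^2+\kappa$ on $\mathbb R^3$: for $t>0$ it is smooth in $(x,y,z,x',y',z')$ and satisfies $$\partial_t\mathbb G+Ay\,\partial_x\mathbb G+\Delta\mathbb G+4\Delta^2\mathbb G+\kappa\,\mathbb G=0$$ in $(t,x,y,z)$, and as $t\to0^+$ it converges to $\delta(x-x',y-y',z-z')$, in the sense that its integral in $(x,y,z)$ against any bounded continuous function $f$ tends to $f(x',y',z')$. For a kernel $K(x,y,z;x',y',z')$ and $1\le p\le\infty$ put $$\interleave K\interleave_{L^p}=\max\Big\{\sup_{x,y,z}\|K(x,y,z;\cdot,\cdot,\cdot)\|_{L^p(\mathbb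 R^3)},\ \sup_{x',y',z'}\|K(\cdot,\cdot,\cdot;x',y',z')\|_{L^p(\mathbb R^3)}\Big\}.$$ Then there is a constant $C>0$, depending only on $\kappa$ and $\varepsilon$, such that for all $A>0$, all $t>0$, all $1\le p\le\infty$ and all non-negative integers $k_1,k_2,k_3$ with $k=k_1+k_2+k_3\le6$, $$\interleave\partial_x^{k_1}\partial_y^{k_2}\partial_z^{k_3}\mathbb G(t)\interleave_{L^p}\le C\,e^{-\varepsilon t}\,t^{-\frac34(1-\frac1p)-\frac k4}\big(1+(At)^4\big)^{-\frac14(1-\frac1p)-\frac{k_1}4}$$ and $$\interleave\partial_{x'}^{k_1}\partial_{y'}^{k_2}\partial_{z'}^{k_3}\mathbb G(t)\interleave_{L^p}\le C\,e^{-\varepsilon t}\,t^{-\frac34(1-\frac1p)-\frac k4}\big(1+(At)^4\big)^{-\frac14(1-\frac1p)-\frac{k_1}4}.$$ -/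

import Mathlib

open MeasureTheory Filter Topology
open scoped ENNReal ContDiff

noncomputable section

namespace Flame

/-- The space variables `(x, y, z)`; `volume` is Lebesgue measure. The `L^p` norms below are
integrals over this space, so the (sup) norm carried by the product plays no role. -/
abbrev R3 : Type := ℝ × ℝ × ℝ

/-- The mixed partial derivative `∂_x^{k₁} ∂_y^{k₂} ∂_z^{k₃} F`. -/
def mixedDeriv (k₁ k₂ k₃ : ℕ) (F : R3 → ℂ) (P : R3) : ℂ :=
  iteratedDeriv k₁ (fun x => iteratedDeriv k₂ (fun y =>
    iteratedDeriv k₃ (fun z => F (x, y, z)) P.2.2) P.2.1) P.1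

/-- The Laplacian `Δ = ∂_x² + ∂_y² + ∂_z²`. -/
def laplacian (F : R3 → ℂ) (P : R3) : ℂ :=
  mixedDeriv 2 0 0 F P + mixedDeriv 0 2 0 F P + mixedDeriv 0 0 2 F P

/-- The spatial part `A y ∂_x + Δ + 4 Δ² + κ` of the linearized operator. -/
def spatialOp (A κ : ℝ) (F : R3 → ℂ) (P : R3) : ℂ :=
  (A : ℂ) * (P.2.1 : ℂ) * mixedDeriv 1 0 0 F P + laplacian F P
    + 4 * laplacian (laplacian F) P + (κ : ℂ) * F P

/-- `G t P P'` is a fundamental solution of `∂_t + A y ∂_x + Δ + 4 Δ² + κ`: for `t > 0` it is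
smooth in `(P, P')`, it solves the equation in `(t, P)` classically for every source point `P'`,
and it tends to the Dirac mass at `P'` as `t → 0⁺` (tested with all bounded continuous
functions of `P`). -/
structure IsFundamentalSolution (A κ : ℝ) (G : ℝ → R3 → R3 → ℂ) : Prop where
  smooth : ∀ t : ℝ, 0 < t → ContDiff ℝ ∞ (fun q : R3 × R3 => G t q.1 q.2)
  equation : ∀ t : ℝ, 0 < t → ∀ P P' : R3,
    HasDerivAt (fun s : ℝ => G s P P') (-spatialOp A κ (fun Q => G t Q P') P) t
  initial : ∀ (P' : R3) (f : BoundedContinuousFunction R3 ℂ),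
    Tendsto (fun t : ℝ => ∫ P : R3, G t P P' * f P) (𝓝[>] 0) (𝓝 (f P'))

/-- The factor `exp (-i x' ξ - i y' (η + A ξ t) - i z' ζ)` of the Fourier transform of the
Green's function; `P' = (x', y', z')` and `k = (ξ, η, ζ)`. -/
def greenHat₁ (A t : ℝ) (P' k : R3) : ℂ :=
  Complex.exp (-Complex.I *
    ((P'.1 * k.1 + P'.2.1 * (k.2.1 + A * k.1 * t) + P'.2.2 * k.2.2 : ℝ) : ℂ))

/-- The sheared symbol `ξ² + (η + A ξ s)² + ζ²`. -/
def shearSymbol (A s : ℝ) (k : R3) : ℝ :=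
  k.1 ^ 2 + (k.2.1 + A * k.1 * s) ^ 2 + k.2.2 ^ 2

/-- The factor
`exp (∫₀ᵗ [ξ² + (η + A ξ s)² + ζ² - κ - 4 (ξ² + (η + A ξ s)² + ζ²)²] ds)`
of the Fourier transform of the Green's function. -/
def greenHat₂ (A κ t : ℝ) (k : R3) : ℝ :=
  Real.exp (∫ s in (0 : ℝ)..t, (shearSymbol A s k - κ - 4 * shearSymbol A s k ^ 2))

/-- The Green's function `G(t, x - x', y, z - z'; y')` at `P = (x, y, z)`, `P' = (x', y', z')`:
the inverse Fourier transform in `(ξ, η, ζ)` (normalized by `(2π)⁻³`, so that the initial value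
is a unit Dirac mass) of the product of the two factors above. -/
def greenFunction (A κ t : ℝ) (P P' : R3) : ℂ :=
  (((2 * Real.pi) ^ 3)⁻¹ : ℝ) * ∫ k : R3,
    Complex.exp (Complex.I * ((P.1 * k.1 + P.2.1 * k.2.1 + P.2.2 * k.2.2 : ℝ) : ℂ))
      * (greenHat₁ A t P' k * (greenHat₂ A κ t k : ℂ))

/-- The mixed norm of a kernel `K(P, P')`: the larger one of the supremum over `P` of the `L^p`
norm in `P'` and the supremum over `P'` of the `L^p` norm in `P`. -/
def kernelNorm (p : ℝ≥0∞) (K : R3 → R3 → ℂ) : ℝ≥0∞ :=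
  max (⨆ P : R3, eLpNorm (fun P' => K P P') p volume)
    (⨆ P' : R3, eLpNorm (fun P => K P P') p volume)

/-- The bound `C e^{-εt} t^{-(3/4)(1-1/p)-k/4} (1+(At)⁴)^{-(1/4)(1-1/p)-k₁/4}`
(with `1/p = 0` for `p = ∞`). -/
def decayBound (C ε A t : ℝ) (p : ℝ≥0∞) (k₁ k : ℕ) : ℝ :=
  C * Real.exp (-ε * t) * t ^ (-(3 / 4 : ℝ) * (1 - (1 / p).toReal) - (k : ℝ) / 4)
    * (1 + (A * t) ^ 4) ^ (-(1 / 4 : ℝ) * (1 - (1 / p).toReal) - (k₁ : ℝ) / 4)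

end Flame

end

open scoped FourierTransform

noncomputable section

namespace Flame

/-! The amplitude is a unimodular phase times `exp Φ`, with Φ an explicit polynomial in the
frequencies. Put r = t^{1/4}, ρ = (1 + (At)⁴)^{1/4} and pass to the frequencies rρξ, rη, rζ. Then Φ
= -εt + Ψ with Ψ = ∫₀¹ (-(κ-ε)τ² + τu - 4u²) dσ (`scaledExponent`), a polynomial that sees A and t
only through τ = t^{1/2}, a = 1/ρ, b = At/ρ. The pair (a, b) ranges in a compact set away from the
origin, so the mean of u is at least |k|²/16. Since τu - 4u² - τ²/16 = -(τ/4 - 2u)², the condition κ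
- ε > 1/16 yields Ψ ≤ -c(τ² + |k|⁴) uniformly (`exists_scaledExponent_le`).

Two integrations by parts in each frequency then bound the rescaled kernels by a multiple of ∏ⱼ (1 +
wⱼ²)⁻¹, uniformly in A and t (`PolyFun.exists_norm_oscInt_le`). Undoing the scaling produces the
powers of r and ρ (`exists_norm_oscInt_greenAmplitude_le`). The weight is integrable with values in
[0, 1], which settles every L^p norm at once, and the kernel depends on the two points through a
sheared difference that preserves Lebesgue measure in each of them.

For the equation, multiplication by y is i∂_η on amplitudes, and Aξ∂_η acts on v(s) as ∂_s. The
transport term therefore exchanges v(t) for v(0) = |k|², the symbol of -Δ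
(`hasLineDerivAt_greenSource`). For the initial value, space is rescaled by t^{1/4}: the kernel is
then dominated by a fixed integrable function, its mass is e^{-κt} by Fourier inversion, and
dominated convergence applies. -/

/-! ### Gaussian decay and polynomial growth. -/

/-- The squared Euclidean norm on `R3`. -/
def sqNorm (k : R3) : ℝ := k.1 ^ 2 + k.2.1 ^ 2 + k.2.2 ^ 2

lemma sqNorm_nonneg (k : R3) : 0 ≤ sqNorm k := by unfold sqNorm; positivity

lemma exists_one_add_pow_le_exp (m : ℕ) {c : ℝ} (hc : 0 < c) :
    ∃ C, 0 < C ∧ ∀ x, 0 ≤ x → (1 + x) ^ m ≤ C * Real.exp (c * x) := by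
  -- M ≥ 1 gives 1 + x ≤ M exp(x/M), and M ≥ m/c keeps the rate m/M of the m-th power at most c.
  set M : ℝ := max 1 (m / c)
  have hM1 : 1 ≤ M := le_max_left _ _
  have hM0 : 0 < M := by linarith
  have hM2 : m / M ≤ c := by
    rw [div_le_iff₀ hM0]
    have := (div_le_iff₀ hc).1 (le_max_right 1 (m / c))
    linarith [mul_comm c M]
  refine ⟨M ^ m, by positivity, fun x hx => ?_⟩
  have h1 : 1 + x ≤ M * Real.exp (x / M) := by
    have := mul_le_mul_of_nonneg_left (Real.add_one_le_exp (x / M)) hM0.le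
    rw [mul_add, mul_div_cancel₀ _ hM0.ne'] at this
    linarith
  calc (1 + x) ^ m ≤ (M * Real.exp (x / M)) ^ m := pow_le_pow_left₀ (by linarith) h1 m
    _ = M ^ m * Real.exp (m / M * x) := by
      rw [mul_pow, ← Real.exp_nat_mul]; congr 2; ring
    _ ≤ _ := by gcongr

lemma integrable_exp_neg_sqNorm {c : ℝ} (hc : 0 < c) :
    Integrable (fun k : R3 => Real.exp (-c * sqNorm k)) := by
  have h := integrable_exp_neg_mul_sq hc
  refine (h.mul_prod (h.mul_prod h)).congr (Eventually.of_forall fun k => ?_)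
  simp only [sqNorm, ← Real.exp_add]
  congr 1; ring

/-- Continuous functions bounded by a Gaussian. -/
structure GaussDecay (F : R3 → ℂ) : Prop where
  continuous : Continuous F
  bound : ∃ C c : ℝ, 0 < c ∧ ∀ k, ‖F k‖ ≤ C * Real.exp (-c * sqNorm k)

/-- Continuous functions of at most polynomial growth. -/
structure PolyGrowth (g : R3 → ℂ) : Prop where
  continuous : Continuous g
  bound : ∃ (C : ℝ) (m : ℕ), 0 ≤ C ∧ ∀ k, ‖g k‖ ≤ C * (1 + sqNorm k) ^ m

lemma GaussDecay.integrable {F : R3 → ℂ} (hF : GaussDecay F) : Integrable F := by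
  obtain ⟨C, c, hc, h⟩ := hF.bound
  exact ((integrable_exp_neg_sqNorm hc).const_mul C).mono' hF.continuous.aestronglyMeasurable
    (Eventually.of_forall h)

lemma PolyGrowth.mul_gaussDecay {g F : R3 → ℂ} (hg : PolyGrowth g) (hF : GaussDecay F) :
    GaussDecay (fun k => g k * F k) := by
  refine ⟨hg.continuous.mul hF.continuous, ?_⟩
  obtain ⟨C, c, hc, h⟩ := hF.bound
  obtain ⟨C', m, hC', h'⟩ := hg.bound
  obtain ⟨D, hD, hDm⟩ := exists_one_add_pow_le_exp m (half_pos hc)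
  refine ⟨C' * D * C, c / 2, half_pos hc, fun k => ?_⟩
  rw [norm_mul]
  have hk := sqNorm_nonneg k
  calc ‖g k‖ * ‖F k‖ ≤ (C' * (D * Real.exp (c / 2 * sqNorm k)))
        * (C * Real.exp (-c * sqNorm k)) := by
        refine mul_le_mul ((h' k).trans ?_) (h k) (norm_nonneg _) (by positivity)
        exact mul_le_mul_of_nonneg_left (hDm _ hk) hC'
    _ = C' * D * C * (Real.exp (c / 2 * sqNorm k) * Real.exp (-c * sqNorm k)) := by ring
    _ = _ := by rw [← Real.exp_add]; congr 2; ring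

namespace PolyGrowth

lemma of_bounded {g : R3 → ℂ} (hg : Continuous g) {C : ℝ} (h : ∀ k, ‖g k‖ ≤ C) :
    PolyGrowth g :=
  ⟨hg, C, 0, (norm_nonneg _).trans (h 0), fun k => by simpa using h k⟩

lemma const (c : ℂ) : PolyGrowth (fun _ => c) := of_bounded continuous_const fun _ => le_rfl

lemma mul {f g : R3 → ℂ} (hf : PolyGrowth f) (hg : PolyGrowth g) :
    PolyGrowth (fun k => f k * g k) := by
  obtain ⟨C, m, hC, h⟩ := hf.bound
  obtain ⟨C', m', hC', h'⟩ := hg.bound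
  refine ⟨hf.continuous.mul hg.continuous, C * C', m + m', by positivity, fun k => ?_⟩
  have hk := sqNorm_nonneg k
  rw [norm_mul, pow_add]
  calc _ ≤ _ := mul_le_mul (h k) (h' k) (norm_nonneg _) (by positivity)
    _ = _ := by ring

lemma add {f g : R3 → ℂ} (hf : PolyGrowth f) (hg : PolyGrowth g) :
    PolyGrowth (fun k => f k + g k) := by
  obtain ⟨C, m, hC, h⟩ := hf.bound
  obtain ⟨C', m', hC', h'⟩ := hg.bound
  refine ⟨hf.continuous.add hg.continuous, C + C', m + m', by positivity, fun k => ?_⟩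
  have hk : 1 ≤ 1 + sqNorm k := by linarith [sqNorm_nonneg k]
  have h1 : (1 + sqNorm k) ^ m ≤ (1 + sqNorm k) ^ (m + m') :=
    pow_le_pow_right₀ hk (Nat.le_add_right _ _)
  have h2 : (1 + sqNorm k) ^ m' ≤ (1 + sqNorm k) ^ (m + m') :=
    pow_le_pow_right₀ hk (Nat.le_add_left _ _)
  calc ‖f k + g k‖ ≤ ‖f k‖ + ‖g k‖ := norm_add_le _ _
    _ ≤ C * (1 + sqNorm k) ^ (m + m') + C' * (1 + sqNorm k) ^ (m + m') :=
      add_le_add ((h k).trans (mul_le_mul_of_nonneg_left h1 hC))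
        ((h' k).trans (mul_le_mul_of_nonneg_left h2 hC'))
    _ = _ := by ring

lemma pow {f : R3 → ℂ} (hf : PolyGrowth f) (n : ℕ) : PolyGrowth (fun k => f k ^ n) := by
  induction n with
  | zero => simpa using const 1
  | succ n ih => simpa only [pow_succ] using ih.mul hf

lemma of_abs_le {g : R3 → ℝ} (hg : Continuous g) (h : ∀ k, g k ^ 2 ≤ sqNorm k) :
    PolyGrowth (fun k => (g k : ℂ)) := by
  refine ⟨by fun_prop, 1, 1, zero_le_one, fun k => ?_⟩
  rw [Complex.norm_real, Real.norm_eq_abs, abs_le]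
  constructor <;> nlinarith [h k, sq_nonneg (g k - 1), sq_nonneg (g k + 1)]

lemma fst : PolyGrowth (fun k => (k.1 : ℂ)) :=
  of_abs_le (by fun_prop) fun k => by unfold sqNorm; nlinarith [sq_nonneg k.2.1, sq_nonneg k.2.2]

lemma snd : PolyGrowth (fun k => (k.2.1 : ℂ)) :=
  of_abs_le (by fun_prop) fun k => by unfold sqNorm; nlinarith [sq_nonneg k.1, sq_nonneg k.2.2]

lemma thd : PolyGrowth (fun k => (k.2.2 : ℂ)) :=
  of_abs_le (by fun_prop) fun k => by unfold sqNorm; nlinarith [sq_nonneg k.1, sq_nonneg k.2.1]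

lemma phase {g : R3 → ℝ} (hg : Continuous g) :
    PolyGrowth (fun k => Complex.exp (Complex.I * (g k : ℂ))) := by
  refine of_bounded (C := 1) (by fun_prop) fun k => ?_
  rw [mul_comm, Complex.norm_exp_ofReal_mul_I]

end PolyGrowth

/-! ### Differentiation of oscillatory integrals. -/

lemma norm_exp_I_mul_ofReal (x : ℝ) : ‖Complex.exp (Complex.I * (x : ℂ))‖ = 1 := by
  rw [mul_comm, Complex.norm_exp_ofReal_mul_I]

lemma continuous_of_polyGrowth {α : R3 → ℝ} (hα : PolyGrowth (fun k => (α k : ℂ))) :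
    Continuous α := by
  have := Complex.continuous_re.comp hα.continuous
  simpa [Function.comp_def] using this

lemma hasDerivAt_integral_phase {α : R3 → ℝ} (hα : PolyGrowth (fun k => (α k : ℂ)))
    {F : R3 → ℂ} (hF : GaussDecay F) (x : ℝ) :
    HasDerivAt (fun x : ℝ => ∫ k, Complex.exp (Complex.I * ((x * α k : ℝ) : ℂ)) * F k)
      (∫ k, Complex.exp (Complex.I * ((x * α k : ℝ) : ℂ)) * ((Complex.I * α k) * F k)) x := by
  have hα' := continuous_of_polyGrowth hα
  have hG : GaussDecay (fun k => (Complex.I * α k) * F k) :=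
    ((PolyGrowth.const _).mul hα).mul_gaussDecay hF
  refine (hasDerivAt_integral_of_dominated_loc_of_deriv_le
    (F := fun (x : ℝ) k => Complex.exp (Complex.I * ((x * α k : ℝ) : ℂ)) * F k)
    (F' := fun (x : ℝ) k => Complex.exp (Complex.I * ((x * α k : ℝ) : ℂ)) *
      ((Complex.I * α k) * F k))
    (bound := fun k => ‖(Complex.I * α k) * F k‖) (s := Set.univ) univ_mem ?_ ?_ ?_ ?_ ?_ ?_).2
  · refine Eventually.of_forall fun y => Continuous.aestronglyMeasurable ?_
    exact ((PolyGrowth.phase (by fun_prop)).mul_gaussDecay hF).continuous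
  · exact ((PolyGrowth.phase (by fun_prop)).mul_gaussDecay hF).integrable
  · exact ((PolyGrowth.phase (by fun_prop)).mul_gaussDecay hG).continuous.aestronglyMeasurable
  · refine Eventually.of_forall fun k y _ => ?_
    rw [norm_mul, norm_exp_I_mul_ofReal, one_mul]
  · exact hG.integrable.norm
  · refine Eventually.of_forall fun k y _ => ?_
    have h1 : HasDerivAt (fun y : ℝ => Complex.I * ((y * α k : ℝ) : ℂ)) (Complex.I * α k) y := by
      have h0 : HasDerivAt (fun y : ℝ => y * α k) (α k) y := by
        simpa using (hasDerivAt_id y).mul_const (α k)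
      exact h0.ofReal_comp.const_mul Complex.I
    have := h1.cexp.mul_const (F k)
    simpa only [mul_assoc] using this

lemma iteratedDeriv_integral_phase {α : R3 → ℝ} (hα : PolyGrowth (fun k => (α k : ℂ)))
    {F : R3 → ℂ} (hF : GaussDecay F) (n : ℕ) :
    iteratedDeriv n (fun x : ℝ => ∫ k, Complex.exp (Complex.I * ((x * α k : ℝ) : ℂ)) * F k)
      = fun x => ∫ k, Complex.exp (Complex.I * ((x * α k : ℝ) : ℂ))
          * ((Complex.I * α k) ^ n * F k) := by
  induction n with
  | zero => simp
  | succ n ih =>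
    rw [iteratedDeriv_succ, ih]
    funext x
    rw [(hasDerivAt_integral_phase hα
      ((((PolyGrowth.const _).mul hα).pow n).mul_gaussDecay hF) x).deriv]
    simp only [pow_succ', mul_assoc]

/-- The oscillatory integral `∫ exp (i (x α + y β + z γ)) F` as a function of `(x, y, z)`. -/
def phaseIntegral (α β γ : R3 → ℝ) (F : R3 → ℂ) (P : R3) : ℂ :=
  ∫ k, Complex.exp (Complex.I * ((P.1 * α k + P.2.1 * β k + P.2.2 * γ k : ℝ) : ℂ)) * F k

/-- One variable is treated at a time: the phases of the other two are unimodular and can be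
absorbed into the amplitude, which keeps its Gaussian decay. General phases are allowed because y'
is paired with η + Aξt rather than with a coordinate. -/
lemma mixedDeriv_phaseIntegral {α β γ : R3 → ℝ} (hα : PolyGrowth (fun k => (α k : ℂ)))
    (hβ : PolyGrowth (fun k => (β k : ℂ))) (hγ : PolyGrowth (fun k => (γ k : ℂ)))
    {F : R3 → ℂ} (hF : GaussDecay F) (k₁ k₂ k₃ : ℕ) :
    mixedDeriv k₁ k₂ k₃ (phaseIntegral α β γ F)
      = phaseIntegral α β γ (fun k => (Complex.I * α k) ^ k₁ * ((Complex.I * β k) ^ k₂ *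
          ((Complex.I * γ k) ^ k₃ * F k))) := by
  have hα' := continuous_of_polyGrowth hα
  have hβ' := continuous_of_polyGrowth hβ
  have hγ' := continuous_of_polyGrowth hγ
  have hI := PolyGrowth.const Complex.I
  have hexp : ∀ (a b : ℝ), Complex.exp (Complex.I * ((a + b : ℝ) : ℂ))
      = Complex.exp (Complex.I * (a : ℂ)) * Complex.exp (Complex.I * (b : ℂ)) := fun a b => by
    rw [← Complex.exp_add]; push_cast; ring_nf
  have h3 : ∀ x y z, iteratedDeriv k₃ (fun z => phaseIntegral α β γ F (x, y, z)) z
      = phaseIntegral α β γ (fun k => (Complex.I * γ k) ^ k₃ * F k) (x, y, z) := by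
    intro x y z
    have h := congrFun (iteratedDeriv_integral_phase hγ (F := fun k =>
      Complex.exp (Complex.I * ((x * α k + y * β k : ℝ) : ℂ)) * F k)
      ((PolyGrowth.phase (by fun_prop)).mul_gaussDecay hF) k₃) z
    refine Eq.trans ?_ (h.trans ?_)
    · congr 1; funext z'; refine integral_congr_ae (Eventually.of_forall fun k => ?_)
      simp only [hexp]; ring
    · refine integral_congr_ae (Eventually.of_forall fun k => ?_)
      simp only [hexp]; ring
  have hF3 : GaussDecay (fun k => (Complex.I * γ k) ^ k₃ * F k) :=
    ((hI.mul hγ).pow k₃).mul_gaussDecay hF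
  have h2 : ∀ x y z, iteratedDeriv k₂ (fun y => phaseIntegral α β γ
        (fun k => (Complex.I * γ k) ^ k₃ * F k) (x, y, z)) y
      = phaseIntegral α β γ (fun k => (Complex.I * β k) ^ k₂ *
        ((Complex.I * γ k) ^ k₃ * F k)) (x, y, z) := by
    intro x y z
    have h := congrFun (iteratedDeriv_integral_phase hβ (F := fun k =>
      Complex.exp (Complex.I * ((x * α k + z * γ k : ℝ) : ℂ)) * ((Complex.I * γ k) ^ k₃ * F k))
      ((PolyGrowth.phase (by fun_prop)).mul_gaussDecay hF3) k₂) y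
    refine Eq.trans ?_ (h.trans ?_)
    · congr 1; funext z'; refine integral_congr_ae (Eventually.of_forall fun k => ?_)
      simp only [hexp]; ring
    · refine integral_congr_ae (Eventually.of_forall fun k => ?_)
      simp only [hexp]; ring
  have hF2 : GaussDecay (fun k => (Complex.I * β k) ^ k₂ * ((Complex.I * γ k) ^ k₃ * F k)) :=
    ((hI.mul hβ).pow k₂).mul_gaussDecay hF3
  funext P
  obtain ⟨x, y, z⟩ := P
  simp only [mixedDeriv, h3, h2]
  have h := congrFun (iteratedDeriv_integral_phase hα (F := fun k =>
      Complex.exp (Complex.I * ((y * β k + z * γ k : ℝ) : ℂ)) *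
        ((Complex.I * β k) ^ k₂ * ((Complex.I * γ k) ^ k₃ * F k)))
      ((PolyGrowth.phase (by fun_prop)).mul_gaussDecay hF2) k₁) x
  refine Eq.trans ?_ (h.trans ?_)
  · congr 1; funext z'; refine integral_congr_ae (Eventually.of_forall fun k => ?_)
    simp only [hexp]; ring
  · refine integral_congr_ae (Eventually.of_forall fun k => ?_)
    simp only [hexp]; ring

/-! ### Integration by parts and decay uniform in a parameter. -/

/-- The integral `∫ exp (i w · k) F k dk`. -/
abbrev oscInt (F : R3 → ℂ) (w : R3) : ℂ :=
  phaseIntegral (fun k => k.1) (fun k => k.2.1) (fun k => k.2.2) F w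

instance : (volume : Measure R3).IsAddHaarMeasure :=
  have : ((volume : Measure ℝ).prod (volume : Measure ℝ)).IsAddHaarMeasure := inferInstance
  Measure.prod.instIsAddHaarMeasure (volume : Measure ℝ)
    ((volume : Measure ℝ).prod (volume : Measure ℝ))

/-- The dot product on `R3`. -/
def dot (w k : R3) : ℝ := w.1 * k.1 + w.2.1 * k.2.1 + w.2.2 * k.2.2

lemma continuous_dot (w : R3) : Continuous (dot w) := by unfold dot; fun_prop

lemma hasLineDerivAt_exp_dot (w v k : R3) :
    HasLineDerivAt ℝ (fun k : R3 => Complex.exp (Complex.I * (dot w k : ℂ)))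
      (Complex.exp (Complex.I * (dot w k : ℂ)) * (Complex.I * dot w v)) k v := by
  have h0 : HasDerivAt (fun t : ℝ => dot w (k + t • v)) (dot w v) 0 := by
    have : (fun t : ℝ => dot w (k + t • v)) = fun t => dot w k + t * dot w v := by
      funext t; simp [dot]; ring
    rw [this]
    simpa using ((hasDerivAt_id (0 : ℝ)).mul_const (dot w v)).const_add (dot w k)
  have := (h0.ofReal_comp.const_mul Complex.I).cexp
  simpa [HasLineDerivAt] using this

/-- Integration by parts along v: the factor i(w·v) is the derivative of the phase, and Gaussian
decay removes boundary terms. -/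
lemma dot_mul_oscInt {F F' : R3 → ℂ} (hF : GaussDecay F) (hF' : GaussDecay F') {v : R3}
    (h : ∀ k, HasLineDerivAt ℝ F (F' k) k v) (w : R3) :
    (dot w v : ℂ) * oscInt F w = Complex.I * oscInt F' w := by
  have hE : PolyGrowth (fun k => Complex.exp (Complex.I * (dot w k : ℂ))) :=
    PolyGrowth.phase (continuous_dot w)
  have hE' := (hE.mul (PolyGrowth.const (Complex.I * dot w v)))
  have key := integral_bilinear_hasLineDerivAt_right_eq_neg_left_of_integrable
    (μ := (volume : Measure R3)) (B := ContinuousLinearMap.mul ℝ ℂ) (v := v)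
    (f := fun k : R3 => Complex.exp (Complex.I * (dot w k : ℂ)))
    (f' := fun k => Complex.exp (Complex.I * (dot w k : ℂ)) * (Complex.I * dot w v))
    (g := F) (g' := F') (hE'.mul_gaussDecay hF).integrable (hE.mul_gaussDecay hF').integrable
    (hE.mul_gaussDecay hF).integrable (fun k _ => hasLineDerivAt_exp_dot w v k) (fun k _ => h k)
  simp only [ContinuousLinearMap.mul_apply'] at key
  have e1 : oscInt F' w = ∫ k, Complex.exp (Complex.I * (dot w k : ℂ)) * F' k := rfl
  have e2 : oscInt F w = ∫ k, Complex.exp (Complex.I * (dot w k : ℂ)) * F k := rfl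
  rw [e1, key, e2, mul_neg, ← integral_const_mul, ← integral_const_mul, ← integral_neg]
  refine integral_congr_ae (Eventually.of_forall fun k => ?_)
  simp only
  linear_combination ((dot w v : ℂ) * Complex.exp (Complex.I * (dot w k : ℂ)) * F k)
    * Complex.I_mul_I

/-- Polynomials in a parameter `θ` and a variable `k`. -/
inductive PolyFun : (R3 → R3 → ℝ) → Prop
  | const (c : ℝ) : PolyFun fun _ _ => c
  | var₁ : PolyFun fun _ k => k.1
  | var₂ : PolyFun fun _ k => k.2.1
  | var₃ : PolyFun fun _ k => k.2.2
  | par₁ : PolyFun fun θ _ => θ.1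
  | par₂ : PolyFun fun θ _ => θ.2.1
  | par₃ : PolyFun fun θ _ => θ.2.2
  | add {p q : R3 → R3 → ℝ} : PolyFun p → PolyFun q → PolyFun fun θ k => p θ k + q θ k
  | mul {p q : R3 → R3 → ℝ} : PolyFun p → PolyFun q → PolyFun fun θ k => p θ k * q θ k

namespace PolyFun

lemma pow {p : R3 → R3 → ℝ} (hp : PolyFun p) (n : ℕ) : PolyFun fun θ k => p θ k ^ n := by
  induction n with
  | zero => simpa using const 1
  | succ n ih => simpa only [pow_succ] using ih.mul hp

lemma sub {p q : R3 → R3 → ℝ} (hp : PolyFun p) (hq : PolyFun q) :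
    PolyFun fun θ k => p θ k - q θ k := by
  simpa [sub_eq_add_neg] using hp.add ((const (-1)).mul hq)

lemma continuous {p : R3 → R3 → ℝ} (hp : PolyFun p) (θ : R3) : Continuous (p θ) := by
  induction hp with
  | const | par₁ | par₂ | par₃ => exact continuous_const
  | var₁ | var₂ | var₃ => fun_prop
  | add _ _ h1 h2 => exact h1.add h2
  | mul _ _ h1 h2 => exact h1.mul h2

/-- The derivative is a single polynomial in θ and k, chosen before θ. This is what makes all
constants obtained by integrating by parts independent of the parameter. -/
lemma exists_hasLineDerivAt {p : R3 → R3 → ℝ} (hp : PolyFun p) (v : R3) :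
    ∃ p', PolyFun p' ∧ ∀ θ k, HasLineDerivAt ℝ (p θ) (p' θ k) k v := by
  have aff : ∀ a b : ℝ, HasDerivAt (fun t : ℝ => a + t * b) b 0 := fun a b => by
    simpa using ((hasDerivAt_id (0 : ℝ)).mul_const b).const_add a
  induction hp with
  | const | par₁ | par₂ | par₃ => exact ⟨_, const 0, fun θ k => hasDerivAt_const _ _⟩
  | var₁ => exact ⟨_, const v.1, fun θ k => by simpa [HasLineDerivAt] using aff k.1 v.1⟩
  | var₂ => exact ⟨_, const v.2.1, fun θ k => by simpa [HasLineDerivAt] using aff k.2.1 v.2.1⟩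
  | var₃ => exact ⟨_, const v.2.2, fun θ k => by simpa [HasLineDerivAt] using aff k.2.2 v.2.2⟩
  | add _ _ h1 h2 =>
    obtain ⟨p', hp', h1⟩ := h1
    obtain ⟨q', hq', h2⟩ := h2
    exact ⟨_, hp'.add hq', fun θ k => HasDerivAt.add (h1 θ k) (h2 θ k)⟩
  | @mul p q hp hq h1 h2 =>
    obtain ⟨p', hp', h1⟩ := h1
    obtain ⟨q', hq', h2⟩ := h2
    refine ⟨_, (hp'.mul hq).add (hp.mul hq'), fun θ k => ?_⟩
    have := HasDerivAt.mul (h1 θ k) (h2 θ k)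
    simpa [HasLineDerivAt] using! this

lemma exists_bound {p : R3 → R3 → ℝ} (hp : PolyFun p) :
    ∃ (C : ℝ) (m : ℕ), 0 ≤ C ∧ ∀ θ k, |p θ k| ≤ C * (1 + (sqNorm θ + sqNorm k)) ^ m := by
  have hN : ∀ θ k, 0 ≤ sqNorm θ + sqNorm k := fun θ k =>
    add_nonneg (sqNorm_nonneg θ) (sqNorm_nonneg k)
  have lin : ∀ x s : ℝ, x ^ 2 ≤ s → |x| ≤ 1 * (1 + s) ^ 1 := fun x s h => by
    rw [abs_le]; constructor <;> nlinarith [sq_nonneg (x - 1), sq_nonneg (x + 1)]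
  have low : ∀ θ k : R3, k.1 ^ 2 ≤ sqNorm θ + sqNorm k ∧ k.2.1 ^ 2 ≤ sqNorm θ + sqNorm k ∧
      k.2.2 ^ 2 ≤ sqNorm θ + sqNorm k := fun θ k => by
    have := sqNorm_nonneg θ
    simp only [sqNorm] at *
    refine ⟨?_, ?_, ?_⟩ <;> nlinarith [sq_nonneg k.1, sq_nonneg k.2.1, sq_nonneg k.2.2]
  induction hp with
  | const c => exact ⟨|c|, 0, abs_nonneg _, fun θ k => by simp⟩
  | var₁ => exact ⟨1, 1, zero_le_one, fun θ k => lin _ _ (low θ k).1⟩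
  | var₂ => exact ⟨1, 1, zero_le_one, fun θ k => lin _ _ (low θ k).2.1⟩
  | var₃ => exact ⟨1, 1, zero_le_one, fun θ k => lin _ _ (low θ k).2.2⟩
  | par₁ => exact ⟨1, 1, zero_le_one, fun θ k => lin _ _ (by have := (low k θ).1; linarith)⟩
  | par₂ => exact ⟨1, 1, zero_le_one, fun θ k => lin _ _ (by have := (low k θ).2.1; linarith)⟩
  | par₃ => exact ⟨1, 1, zero_le_one, fun θ k => lin _ _ (by have := (low k θ).2.2; linarith)⟩
  | @add p q _ _ h1 h2 =>
    obtain ⟨C, m, hC, h⟩ := h1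
    obtain ⟨C', m', hC', h'⟩ := h2
    refine ⟨C + C', m + m', by positivity, fun θ k => ?_⟩
    have hk : 1 ≤ 1 + (sqNorm θ + sqNorm k) := by linarith [hN θ k]
    refine (abs_add_le _ _).trans ((add_le_add
      ((h θ k).trans (mul_le_mul_of_nonneg_left (pow_le_pow_right₀ hk (Nat.le_add_right m m')) hC))
      ((h' θ k).trans (mul_le_mul_of_nonneg_left
        (pow_le_pow_right₀ hk (Nat.le_add_left m' m)) hC'))).trans_eq ?_)
    ring
  | @mul p q _ _ h1 h2 =>
    obtain ⟨C, m, hC, h⟩ := h1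
    obtain ⟨C', m', hC', h'⟩ := h2
    refine ⟨C * C', m + m', by positivity, fun θ k => ?_⟩
    have := hN θ k
    rw [abs_mul, pow_add]
    calc _ ≤ _ := mul_le_mul (h θ k) (h' θ k) (abs_nonneg _) (by positivity)
      _ = _ := by ring

end PolyFun

/-- The amplitude `q exp φ`. -/
def polyExp (φ q : R3 → R3 → ℝ) (θ k : R3) : ℂ := ((q θ k * Real.exp (φ θ k) : ℝ) : ℂ)

section WeightedBounds

variable {φ : R3 → R3 → ℝ} {S : Set R3} {C c : ℝ}

/-- The parameter set may be unbounded. The polynomial may therefore grow in θ too, and the decay of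
exp φ in θ absorbs that growth. -/
lemma PolyFun.exists_norm_polyExp_le (hc : 0 < c)
    (hexp : ∀ θ ∈ S, ∀ k, Real.exp (φ θ k) ≤ C * Real.exp (-c * (sqNorm θ + sqNorm k)))
    {q : R3 → R3 → ℝ} (hq : PolyFun q) :
    ∃ D, ∀ θ ∈ S, ∀ k, ‖polyExp φ q θ k‖ ≤ D * Real.exp (-(c / 2) * sqNorm k) := by
  obtain ⟨C', m, hC', hb⟩ := hq.exists_bound
  obtain ⟨M, hM, hMm⟩ := exists_one_add_pow_le_exp m (half_pos hc)
  refine ⟨C' * M * |C|, fun θ hθ k => ?_⟩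
  have h1 := sqNorm_nonneg θ
  have h2 := sqNorm_nonneg k
  rw [polyExp, Complex.norm_real, Real.norm_eq_abs, abs_mul, Real.abs_exp]
  calc |q θ k| * Real.exp (φ θ k)
      ≤ (C' * (M * Real.exp (c / 2 * (sqNorm θ + sqNorm k)))) *
        (|C| * Real.exp (-c * (sqNorm θ + sqNorm k))) := by
        refine mul_le_mul ((hb θ k).trans ?_) ((hexp θ hθ k).trans ?_) (Real.exp_pos _).le
          (by positivity)
        · exact mul_le_mul_of_nonneg_left (hMm _ (by positivity)) hC'
        · exact mul_le_mul_of_nonneg_right (le_abs_self C) (Real.exp_pos _).le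
    _ = C' * M * |C| * (Real.exp (c / 2 * (sqNorm θ + sqNorm k)) *
          Real.exp (-c * (sqNorm θ + sqNorm k))) := by ring
    _ ≤ _ := by
      rw [← Real.exp_add]
      refine mul_le_mul_of_nonneg_left (Real.exp_le_exp.2 ?_) (by positivity)
      nlinarith

lemma PolyFun.gaussDecay_polyExp (hφ : PolyFun φ) (hc : 0 < c)
    (hexp : ∀ θ ∈ S, ∀ k, Real.exp (φ θ k) ≤ C * Real.exp (-c * (sqNorm θ + sqNorm k)))
    {q : R3 → R3 → ℝ} (hq : PolyFun q) {θ : R3} (hθ : θ ∈ S) :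
    GaussDecay (polyExp φ q θ) := by
  obtain ⟨D, hD⟩ := hq.exists_norm_polyExp_le hc hexp
  refine ⟨?_, D, c / 2, half_pos hc, hD θ hθ⟩
  have h1 := hq.continuous θ
  have h2 := hφ.continuous θ
  unfold polyExp
  fun_prop

/-- Each integration by parts sends q to ∂q + q∂φ and contributes a factor i. Two of them turn
(w·v)² into -q₂, so the new polynomial is q - q₂. -/
lemma PolyFun.exists_one_add_sq_mul_oscInt (hφ : PolyFun φ) (hc : 0 < c)
    (hexp : ∀ θ ∈ S, ∀ k, Real.exp (φ θ k) ≤ C * Real.exp (-c * (sqNorm θ + sqNorm k)))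
    {q : R3 → R3 → ℝ} (hq : PolyFun q) (v : R3) :
    ∃ q', PolyFun q' ∧ ∀ θ ∈ S, ∀ w,
      ((1 + dot w v ^ 2 : ℝ) : ℂ) * oscInt (polyExp φ q θ) w = oscInt (polyExp φ q' θ) w := by
  obtain ⟨φ', hφ', dφ⟩ := hφ.exists_hasLineDerivAt v
  have step : ∀ q, PolyFun q → ∃ q', PolyFun q' ∧ ∀ θ ∈ S, ∀ w,
      (dot w v : ℂ) * oscInt (polyExp φ q θ) w = Complex.I * oscInt (polyExp φ q' θ) w := by
    intro q hq
    obtain ⟨q', hq', dq⟩ := hq.exists_hasLineDerivAt v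
    have hr : PolyFun fun θ k => q' θ k + q θ k * φ' θ k := hq'.add (hq.mul hφ')
    refine ⟨_, hr, fun θ hθ w => dot_mul_oscInt (hφ.gaussDecay_polyExp hc hexp hq hθ)
      (hφ.gaussDecay_polyExp hc hexp hr hθ) (fun k => ?_) w⟩
    have h := (HasDerivAt.mul (dq θ k) (HasDerivAt.exp (dφ θ k))).ofReal_comp
    simp only [zero_smul, add_zero] at h
    have e : (q' θ k + q θ k * φ' θ k) * Real.exp (φ θ k)
      = q' θ k * Real.exp (φ θ k) + q θ k * (Real.exp (φ θ k) * φ' θ k) := by ring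
    simp only [HasLineDerivAt, polyExp, e]
    exact h
  obtain ⟨q₁, hq₁, h₁⟩ := step q hq
  obtain ⟨q₂, hq₂, h₂⟩ := step q₁ hq₁
  refine ⟨_, hq.sub hq₂, fun θ hθ w => ?_⟩
  have e : oscInt (polyExp φ (fun θ k => q θ k - q₂ θ k) θ) w
      = oscInt (polyExp φ q θ) w - oscInt (polyExp φ q₂ θ) w := by
    have hE : PolyGrowth (fun k => Complex.exp (Complex.I * (dot w k : ℂ))) :=
      PolyGrowth.phase (continuous_dot w)
    refine Eq.trans ?_ (integral_sub
      (hE.mul_gaussDecay (hφ.gaussDecay_polyExp hc hexp hq hθ)).integrable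
      (hE.mul_gaussDecay (hφ.gaussDecay_polyExp hc hexp hq₂ hθ)).integrable)
    refine integral_congr_ae (Eventually.of_forall fun k => ?_)
    simp only [polyExp]; push_cast; ring
  rw [e]
  push_cast
  have a := h₁ θ hθ w
  have b := h₂ θ hθ w
  linear_combination (dot w v : ℂ) * a + Complex.I * b
    + oscInt (polyExp φ q₂ θ) w * Complex.I_mul_I

/-- The product weight `∏ⱼ (1 + wⱼ²)⁻¹`. -/
def weight (w : R3) : ℝ := (1 + w.1 ^ 2)⁻¹ * ((1 + w.2.1 ^ 2)⁻¹ * (1 + w.2.2 ^ 2)⁻¹)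

/-- Applying the previous identity along the three axes multiplies the integral by ∏ⱼ (1 + wⱼ²) and
leaves an integral of the same type, bounded by the L¹ norm of its amplitude. -/
lemma PolyFun.exists_norm_oscInt_le (hφ : PolyFun φ) (hc : 0 < c)
    (hexp : ∀ θ ∈ S, ∀ k, Real.exp (φ θ k) ≤ C * Real.exp (-c * (sqNorm θ + sqNorm k)))
    {q : R3 → R3 → ℝ} (hq : PolyFun q) :
    ∃ D, 0 < D ∧ ∀ θ ∈ S, ∀ w, ‖oscInt (polyExp φ q θ) w‖ ≤ D * weight w := by
  obtain ⟨q₁, hq₁, h₁⟩ := hφ.exists_one_add_sq_mul_oscInt hc hexp hq (1, 0, 0)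
  obtain ⟨q₂, hq₂, h₂⟩ := hφ.exists_one_add_sq_mul_oscInt hc hexp hq₁ (0, 1, 0)
  obtain ⟨q₃, hq₃, h₃⟩ := hφ.exists_one_add_sq_mul_oscInt hc hexp hq₂ (0, 0, 1)
  obtain ⟨D, hD⟩ := hq₃.exists_norm_polyExp_le hc hexp
  set E : ℝ := ∫ k, |D| * Real.exp (-(c / 2) * sqNorm k)
  have hE : 0 ≤ E := integral_nonneg fun k => by positivity
  -- `E` is only known to be nonnegative; the added 1 gives a positive constant.
  refine ⟨E + 1, by linarith, fun θ hθ w => ?_⟩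
  have hle : ‖oscInt (polyExp φ q₃ θ) w‖ ≤ E := by
    refine norm_integral_le_of_norm_le
      ((integrable_exp_neg_sqNorm (half_pos hc)).const_mul _) (Eventually.of_forall fun k => ?_)
    rw [norm_mul, norm_exp_I_mul_ofReal, one_mul]
    exact (hD θ hθ k).trans (mul_le_mul_of_nonneg_right (le_abs_self D) (Real.exp_pos _).le)
  rw [← h₃ θ hθ w, ← h₂ θ hθ w, ← h₁ θ hθ w] at hle
  simp only [norm_mul, Complex.norm_real, Real.norm_eq_abs, dot, mul_one, mul_zero, add_zero,
    zero_add] at hle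
  rw [abs_of_nonneg (by positivity), abs_of_nonneg (by positivity),
    abs_of_nonneg (by positivity)] at hle
  have : ‖oscInt (polyExp φ q θ) w‖ ≤ E * weight w := by
    unfold weight
    rw [← mul_inv, ← mul_inv, ← div_eq_mul_inv, le_div_iff₀ (by positivity)]
    linarith
  refine this.trans (mul_le_mul_of_nonneg_right (by linarith) ?_)
  unfold weight; positivity

end WeightedBounds

/-! ### The exponent in closed form and after rescaling. -/

/-- The exponent `∫₀ᵗ (v - κ - 4 v²) ds` of `greenHat₂` in closed form. -/
def greenExponent (A κ t : ℝ) (k : R3) : ℝ :=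
  let x := A * k.1
  let B := k.1 ^ 2 + k.2.2 ^ 2
  let m₁ := k.2.1 ^ 2 * t + k.2.1 * x * t ^ 2 + x ^ 2 * t ^ 3 / 3
  let m₂ := k.2.1 ^ 4 * t + 2 * k.2.1 ^ 3 * x * t ^ 2 + 2 * k.2.1 ^ 2 * x ^ 2 * t ^ 3
    + k.2.1 * x ^ 3 * t ^ 4 + x ^ 4 * t ^ 5 / 5
  B * t + m₁ - κ * t - 4 * (B ^ 2 * t + 2 * B * m₁ + m₂)

lemma hasDerivAt_greenExponent (A κ : ℝ) (k : R3) (t : ℝ) :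
    HasDerivAt (fun s => greenExponent A κ s k)
      (shearSymbol A t k - κ - 4 * shearSymbol A t k ^ 2) t := by
  have h1 := hasDerivAt_id' t
  have h (n : ℕ) := hasDerivAt_pow n t
  set x := A * k.1 with hx
  have hm₁ := (((h 1).const_mul (k.2.1 ^ 2)).add ((h 2).const_mul (k.2.1 * x))).add
    ((h 3).const_mul (x ^ 2 / 3))
  have hm₂ := (((((h 1).const_mul (k.2.1 ^ 4)).add ((h 2).const_mul (2 * k.2.1 ^ 3 * x))).add
    ((h 3).const_mul (2 * k.2.1 ^ 2 * x ^ 2))).add ((h 4).const_mul (k.2.1 * x ^ 3))).add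
    ((h 5).const_mul (x ^ 4 / 5))
  have H := (((h 1).const_mul (k.1 ^ 2 + k.2.2 ^ 2 - κ - 4 * (k.1 ^ 2 + k.2.2 ^ 2) ^ 2)).add
    (hm₁.const_mul (1 - 8 * (k.1 ^ 2 + k.2.2 ^ 2)))).sub (hm₂.const_mul 4)
  refine (H.congr_of_eventuallyEq (Eventually.of_forall fun s => ?_)).congr_deriv ?_
  · simp only [greenExponent, Pi.add_apply, Pi.sub_apply]; ring
  · simp only [shearSymbol]; push_cast; rw [hx]; ring

lemma greenHat₂_eq (A κ t : ℝ) (k : R3) :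
    greenHat₂ A κ t k = Real.exp (greenExponent A κ t k) := by
  rw [greenHat₂, intervalIntegral.integral_eq_sub_of_hasDerivAt
    (fun s _ => hasDerivAt_greenExponent A κ k s)]
  · congr 1
    simp [greenExponent]
  · refine Continuous.intervalIntegrable ?_ _ _
    unfold shearSymbol
    fun_prop

/-- The mean over `σ ∈ [0, 1]` of `u = a² ξ² + (η + b ξ σ)² + ζ²`, for the parameter
`θ = (τ, a, b)`. -/
def meanSymbol (θ k : R3) : ℝ :=
  θ.2.1 ^ 2 * k.1 ^ 2 + k.2.2 ^ 2 + (k.2.1 ^ 2 + k.2.1 * (θ.2.2 * k.1) + (θ.2.2 * k.1) ^ 2 * (1 / 3))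

/-- The variance over `σ ∈ [0, 1]` of `u = a² ξ² + (η + b ξ σ)² + ζ²`. -/
def varSymbol (θ k : R3) : ℝ :=
  (θ.2.2 * k.1) ^ 2 * (k.2.1 ^ 2 * (1 / 3) + k.2.1 * (θ.2.2 * k.1) * (1 / 3)
    + (θ.2.2 * k.1) ^ 2 * (4 / 45))

/-- The rescaled exponent `∫₀¹ (-κ τ² + τ u - 4 u²) dσ`. -/
def scaledExponent (κ : ℝ) (θ k : R3) : ℝ :=
  θ.1 * meanSymbol θ k - κ * θ.1 ^ 2 - 4 * (meanSymbol θ k ^ 2 + varSymbol θ k)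

lemma polyFun_scaledExponent (κ : ℝ) : PolyFun (scaledExponent κ) := by
  have bx : PolyFun fun θ k => θ.2.2 * k.1 := PolyFun.par₃.mul PolyFun.var₁
  have hm : PolyFun meanSymbol :=
    (((PolyFun.par₂.pow 2).mul (PolyFun.var₁.pow 2)).add (PolyFun.var₃.pow 2)).add
      (((PolyFun.var₂.pow 2).add (PolyFun.var₂.mul bx)).add ((bx.pow 2).mul (PolyFun.const _)))
  have hv : PolyFun varSymbol :=
    (bx.pow 2).mul ((((PolyFun.var₂.pow 2).mul (PolyFun.const _)).add
      ((PolyFun.var₂.mul bx).mul (PolyFun.const _))).add ((bx.pow 2).mul (PolyFun.const _)))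
  exact ((PolyFun.par₁.mul hm).sub ((PolyFun.const κ).mul (PolyFun.par₁.pow 2))).sub
    ((PolyFun.const 4).mul ((hm.pow 2).add hv))

/-- Substitute s = tσ with t = r⁴. The rescaled symbol is u = r²v, so tv = τu, tv² = u² and κt =
κτ²; the part εt of κt is split off to supply the decay in time. -/
lemma greenExponent_eq_scaledExponent {A κ ε r ρ a b : ℝ} (ha : a * ρ = 1)
    (hb : b * ρ = A * r ^ 4) (k : R3) :
    greenExponent A κ (r ^ 4) k = -ε * r ^ 4
      + scaledExponent (κ - ε) (r ^ 2, a, b) (r * ρ * k.1, r * k.2.1, r * k.2.2) := by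
  have h1 : a ^ 2 * (r * ρ * k.1) ^ 2 = r ^ 2 * k.1 ^ 2 := by
    linear_combination (r ^ 2 * k.1 ^ 2) * (a * ρ + 1) * ha
  have h2 : b * (r * ρ * k.1) = r * (A * r ^ 4 * k.1) := by
    linear_combination (r * k.1) * hb
  simp only [greenExponent, scaledExponent, meanSymbol, varSymbol, h1, h2]
  ring

/-! ### Coercivity of the rescaled exponent. -/

/-- The range of the parameters `(τ, a, b)`. -/
def paramSet : Set R3 := {θ | θ.2.1 ^ 2 ≤ 1 ∧ θ.2.2 ^ 2 ≤ 1 ∧ 1 ≤ θ.2.1 ^ 2 + θ.2.2 ^ 2}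

lemma sqNorm_le_meanSymbol {θ : R3} (hθ : θ ∈ paramSet) (k : R3) :
    sqNorm k / 16 ≤ meanSymbol θ k := by
  obtain ⟨-, -, h⟩ := hθ
  simp only [sqNorm, meanSymbol]
  have h1 : k.1 ^ 2 ≤ (θ.2.1 ^ 2 + θ.2.2 ^ 2) * k.1 ^ 2 :=
    le_mul_of_one_le_left (sq_nonneg _) h
  -- With x = bξ: η² + ηx + x²/3 - (η² + x²)/16 = (15/16)(η + 8x/15)² + x²/240.
  nlinarith [sq_nonneg (k.2.1 + 8 / 15 * (θ.2.2 * k.1)), sq_nonneg (θ.2.2 * k.1),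
    sq_nonneg (θ.2.1 * k.1), sq_nonneg k.2.2]

lemma varSymbol_nonneg (θ k : R3) : 0 ≤ varSymbol θ k := by
  refine mul_nonneg (sq_nonneg _) ?_
  -- With x = bξ, the bracket equals (η + x/2)²/3 + x²/180.
  nlinarith [sq_nonneg (k.2.1 + (θ.2.2 * k.1) / 2), sq_nonneg (θ.2.2 * k.1)]

/-- Dropping the variance and writing U for the mean, the exponent is at most -(κ - 1/16)τ² - (τ/4 -
2U)². This is where the threshold 1/16 enters. -/
lemma exists_scaledExponent_le {κ : ℝ} (hκ : 1 / 16 < κ) :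
    ∃ c, 0 < c ∧ ∀ θ ∈ paramSet, ∀ k,
      scaledExponent κ θ k ≤ -c * (θ.1 ^ 2 + sqNorm k ^ 2) := by
  -- The cap at 1 lets the same m serve for the square (τ/4 - 2U)², whose coefficient is 1.
  set m := min (κ - 1 / 16) 1
  have hm : 0 < m := lt_min (by linarith) one_pos
  have hm1 : m ≤ κ - 1 / 16 := min_le_left _ _
  have hm2 : m ≤ 1 := min_le_right _ _
  refine ⟨m / 256, by positivity, fun θ hθ k => ?_⟩
  have hU := sqNorm_le_meanSymbol hθ k
  have hV := varSymbol_nonneg θ k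
  have hn := sqNorm_nonneg k
  rw [scaledExponent]
  set U := meanSymbol θ k
  set n := sqNorm k
  set τ := θ.1
  have hU2 : n ^ 2 / 256 ≤ U ^ 2 := by nlinarith
  have h3 : m * (τ ^ 2 + (τ / 4 - 2 * U) ^ 2)
      ≤ (κ - 1 / 16) * τ ^ 2 + (τ / 4 - 2 * U) ^ 2 := by
    nlinarith [sq_nonneg τ, sq_nonneg (τ / 4 - 2 * U)]
  have h4 : (τ ^ 2 + n ^ 2) / 256 ≤ τ ^ 2 + (τ / 4 - 2 * U) ^ 2 := by
    nlinarith [sq_nonneg τ, sq_nonneg (τ / 2 - 2 * U)]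
  have h5 := mul_le_mul_of_nonneg_left h4 hm.le
  nlinarith

lemma exists_exp_scaledExponent_le {κ : ℝ} (hκ : 1 / 16 < κ) :
    ∃ C c, 0 < c ∧ ∀ θ ∈ paramSet, ∀ k,
      Real.exp (scaledExponent κ θ k) ≤ C * Real.exp (-c * (sqNorm θ + sqNorm k)) := by
  obtain ⟨c, hc, h⟩ := exists_scaledExponent_le hκ
  -- The 3 collects a² + b² ≤ 2 and n ≤ n² + 1 with n = |k|², when passing from τ² + n² to |θ|² + n.
  refine ⟨Real.exp (3 * c), c, hc, fun θ hθ k => ?_⟩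
  rw [← Real.exp_add, Real.exp_le_exp]
  refine (h θ hθ k).trans ?_
  obtain ⟨h1, h2, -⟩ := hθ
  simp only [sqNorm] at *
  nlinarith [sq_nonneg (k.1 ^ 2 + k.2.1 ^ 2 + k.2.2 ^ 2 - 1),
    mul_nonneg hc.le (sq_nonneg (k.1 ^ 2 + k.2.1 ^ 2 + k.2.2 ^ 2 - 1)),
    mul_nonneg hc.le (sub_nonneg.2 h1), mul_nonneg hc.le (sub_nonneg.2 h2),
    mul_nonneg hc.le (add_nonneg (add_nonneg (sq_nonneg k.1) (sq_nonneg k.2.1)) (sq_nonneg k.2.2))]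

/-! ### The scales attached to A and t. -/

/-- The length scale `t^{1/4}`. -/
def timeScale (t : ℝ) : ℝ := t ^ (1 / 4 : ℝ)

/-- The shear factor `(1 + (A t)⁴)^{1/4}`. -/
def shearScale (A t : ℝ) : ℝ := (1 + (A * t) ^ 4) ^ (1 / 4 : ℝ)

lemma rpow_quarter_pow_four {x : ℝ} (hx : 0 ≤ x) : (x ^ (1 / 4 : ℝ)) ^ 4 = x := by
  rw [← Real.rpow_natCast, ← Real.rpow_mul hx]; norm_num

lemma timeScale_pos {t : ℝ} (ht : 0 < t) : 0 < timeScale t := Real.rpow_pos_of_pos ht _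

lemma timeScale_pow {t : ℝ} (ht : 0 < t) : timeScale t ^ 4 = t := rpow_quarter_pow_four ht.le

lemma shearScale_pos (A t : ℝ) : 0 < shearScale A t := Real.rpow_pos_of_pos (by positivity) _

lemma shearScale_pow (A t : ℝ) : shearScale A t ^ 4 = 1 + (A * t) ^ 4 :=
  rpow_quarter_pow_four (by positivity)

lemma one_le_shearScale (A t : ℝ) : 1 ≤ shearScale A t :=
  Real.one_le_rpow (by nlinarith [sq_nonneg ((A * t) ^ 2)]) (by norm_num)

/-- The parameters `(τ, a, b)` attached to `A` and `t`. -/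
def scaleParam (A t : ℝ) : R3 := (timeScale t ^ 2, (shearScale A t)⁻¹, A * t / shearScale A t)

/-- ρ⁴ = 1 + (At)⁴ lies between max(1, (At)⁴) and (1 + (At)²)². -/
lemma scaleParam_mem (A t : ℝ) : scaleParam A t ∈ paramSet := by
  have hρ := shearScale_pos A t
  have h4 := shearScale_pow A t
  have h1 := one_le_shearScale A t
  set ρ := shearScale A t
  have hsq : (1 : ℝ) ≤ ρ ^ 2 := one_le_pow₀ h1
  have hA : (A * t) ^ 2 ≤ ρ ^ 2 := by
    refine le_of_sq_le_sq (b := ρ ^ 2) ?_ (by positivity)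
    nlinarith
  have hs : ρ ^ 2 ≤ 1 + (A * t) ^ 2 := by
    refine le_of_sq_le_sq (b := 1 + (A * t) ^ 2) ?_ (by positivity)
    nlinarith [sq_nonneg (A * t)]
  refine ⟨?_, ?_, ?_⟩ <;> simp only [scaleParam]
  · rw [inv_pow]; exact inv_le_one_of_one_le₀ hsq
  · rw [div_pow]; exact (div_le_one (by positivity)).2 hA
  · rw [inv_pow, div_pow, inv_eq_one_div, ← add_div]
    exact (one_le_div (by positivity)).2 hs

lemma greenExponent_eq {t : ℝ} (ht : 0 < t) (A κ ε : ℝ) (k : R3) :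
    greenExponent A κ t k = -ε * t + scaledExponent (κ - ε) (scaleParam A t)
      (timeScale t * shearScale A t * k.1, timeScale t * k.2.1, timeScale t * k.2.2) := by
  have hρ := shearScale_pos A t
  have := greenExponent_eq_scaledExponent (A := A) (κ := κ) (ε := ε) (r := timeScale t)
    (ρ := shearScale A t) (inv_mul_cancel₀ hρ.ne')
    (b := A * t / shearScale A t) (by rw [timeScale_pow ht]; field_simp) k
  rwa [timeScale_pow ht] at this

/-- A Gaussian bound is enough for integrability and domination in time. The term -cτ² = -ct pays
for the step from quartic to quadratic decay, as t|k|² ≤ t(1 + |k|⁴), and ρ ≥ 1 lets the shear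
factor be discarded. -/
lemma exists_greenExponent_le {κ : ℝ} (hκ : 1 / 16 < κ) :
    ∃ c, 0 < c ∧ ∀ A t : ℝ, 0 < t → ∀ k, greenExponent A κ t k ≤ -(c * t) * sqNorm k := by
  obtain ⟨c, hc, h⟩ := exists_scaledExponent_le hκ
  refine ⟨c, hc, fun A t ht k => ?_⟩
  have e := greenExponent_eq ht A κ 0 k
  rw [sub_zero, neg_zero, zero_mul, zero_add] at e
  rw [e]
  refine (h _ (scaleParam_mem A t) _).trans ?_
  have h1 := one_le_shearScale A t
  have hr := timeScale_pos ht
  have h4 := timeScale_pow ht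
  set r := timeScale t
  set ρ := shearScale A t
  have hn := sqNorm_nonneg k
  have hs : r ^ 2 * sqNorm k ≤ sqNorm (r * ρ * k.1, r * k.2.1, r * k.2.2) := by
    have : (1 : ℝ) ≤ ρ ^ 2 := one_le_pow₀ h1
    simp only [sqNorm]
    nlinarith [mul_nonneg (sub_nonneg.2 this) (sq_nonneg (r * k.1))]
  have hs2 : (r ^ 2 * sqNorm k) ^ 2 ≤ sqNorm (r * ρ * k.1, r * k.2.1, r * k.2.2) ^ 2 :=
    pow_le_pow_left₀ (by positivity) hs 2
  have h5 : t * sqNorm k ≤ (scaleParam A t).1 ^ 2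
      + sqNorm (r * ρ * k.1, r * k.2.1, r * k.2.2) ^ 2 := by
    have : (scaleParam A t).1 = r ^ 2 := rfl
    rw [this, ← h4]
    nlinarith [mul_nonneg (sq_nonneg (r ^ 2)) (sq_nonneg (sqNorm k - 1)),
      mul_nonneg (sq_nonneg (r ^ 2)) hn]
  nlinarith [mul_le_mul_of_nonneg_left h5 hc.le]

/-! ### Diagonal changes of variables and the pointwise kernel bound. -/

section Diagonal

variable {d₁ d₂ d₃ : ℝ}

lemma map_diag_volume (h₁ : 0 < d₁) (h₂ : 0 < d₂) (h₃ : 0 < d₃) :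
    Measure.map (fun k : R3 => (d₁ * k.1, d₂ * k.2.1, d₃ * k.2.2)) volume
      = ENNReal.ofReal ((d₁ * d₂ * d₃)⁻¹) • (volume : Measure R3) := by
  have e : (fun k : R3 => (d₁ * k.1, d₂ * k.2.1, d₃ * k.2.2))
      = Prod.map (d₁ * ·) (Prod.map (d₂ * ·) (d₃ * ·)) := rfl
  have hm : ∀ d : ℝ, Measurable fun x : ℝ => d * x := fun d => by fun_prop
  have hv : (volume : Measure R3) = (volume : Measure ℝ).prod (volume.prod volume) := rfl
  rw [e, hv, ← Measure.map_prod_map _ _ (hm _) ((hm _).prodMap (hm _)),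
    ← Measure.map_prod_map _ _ (hm _) (hm _), Real.map_volume_mul_left h₁.ne',
    Real.map_volume_mul_left h₂.ne', Real.map_volume_mul_left h₃.ne']
  simp only [Measure.prod_smul_left, Measure.prod_smul_right, smul_smul]
  rw [← ENNReal.ofReal_mul (by positivity), ← ENNReal.ofReal_mul (by positivity),
    abs_of_pos (by positivity), abs_of_pos (by positivity), abs_of_pos (by positivity)]
  congr 2
  field_simp

lemma measurableEmbedding_diag (h₁ : 0 < d₁) (h₂ : 0 < d₂) (h₃ : 0 < d₃) :
    MeasurableEmbedding (fun k : R3 => (d₁ * k.1, d₂ * k.2.1, d₃ * k.2.2)) := by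
  refine Continuous.measurableEmbedding (by fun_prop) fun k l h => ?_
  simp only [Prod.mk.injEq, mul_right_inj' h₁.ne', mul_right_inj' h₂.ne',
    mul_right_inj' h₃.ne'] at h
  exact Prod.ext h.1 (Prod.ext h.2.1 h.2.2)

lemma integral_comp_diag (h₁ : 0 < d₁) (h₂ : 0 < d₂) (h₃ : 0 < d₃) (f : R3 → ℂ) :
    ∫ k : R3, f (d₁ * k.1, d₂ * k.2.1, d₃ * k.2.2)
      = (((d₁ * d₂ * d₃)⁻¹ : ℝ) : ℂ) * ∫ k, f k := by
  rw [← (measurableEmbedding_diag h₁ h₂ h₃).integral_map, map_diag_volume h₁ h₂ h₃,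
    integral_smul_measure, ENNReal.toReal_ofReal (by positivity), Complex.real_smul]

lemma lintegral_comp_diag (h₁ : 0 < d₁) (h₂ : 0 < d₂) (h₃ : 0 < d₃) (f : R3 → ℝ≥0∞) :
    ∫⁻ k : R3, f (d₁ * k.1, d₂ * k.2.1, d₃ * k.2.2)
      = ENNReal.ofReal ((d₁ * d₂ * d₃)⁻¹) * ∫⁻ k, f k := by
  rw [← (measurableEmbedding_diag h₁ h₂ h₃).lintegral_map, map_diag_volume h₁ h₂ h₃,
    lintegral_smul_measure, smul_eq_mul]

lemma oscInt_comp_diag (h₁ : 0 < d₁) (h₂ : 0 < d₂) (h₃ : 0 < d₃) (F : R3 → ℂ) (w : R3) :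
    oscInt (fun k => F (d₁ * k.1, d₂ * k.2.1, d₃ * k.2.2)) w
      = (((d₁ * d₂ * d₃)⁻¹ : ℝ) : ℂ) * oscInt F (d₁⁻¹ * w.1, d₂⁻¹ * w.2.1, d₃⁻¹ * w.2.2) := by
  unfold oscInt phaseIntegral
  rw [← integral_comp_diag h₁ h₂ h₃]
  refine integral_congr_ae (Eventually.of_forall fun k => ?_)
  simp only
  congr 4
  field_simp

end Diagonal

/-- The frequency multipliers `ξ^k₁ (η + σ A t ξ)^k₂ ζ^k₃` applied to `greenHat₂`. -/
def greenAmplitude (A κ t σ : ℝ) (k₁ k₂ k₃ : ℕ) (k : R3) : ℂ :=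
  ((k.1 ^ k₁ * (k.2.1 + σ * (A * t * k.1)) ^ k₂ * k.2.2 ^ k₃ * greenHat₂ A κ t k : ℝ) : ℂ)

/-- Each multiplier costs r⁻¹, each ξ a further ρ⁻¹, and the Jacobian costs r⁻³ρ⁻¹. The multiplier η
+ σAtξ costs no power of ρ beyond this: in rescaled frequencies it is r⁻¹(η + σbξ) with b bounded.
-/
lemma exists_norm_oscInt_greenAmplitude_le {ε κ : ℝ} (hκ : 1 / 16 + ε < κ)
    (σ : ℝ) (k₁ k₂ k₃ : ℕ) :
    ∃ D, 0 < D ∧ ∀ A t : ℝ, 0 < t → ∀ w : R3,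
      ‖oscInt (greenAmplitude A κ t σ k₁ k₂ k₃) w‖ ≤
        D * Real.exp (-ε * t) * (timeScale t ^ (3 + (k₁ + k₂ + k₃)))⁻¹
          * (shearScale A t ^ (1 + k₁))⁻¹ *
          weight ((timeScale t * shearScale A t)⁻¹ * w.1, (timeScale t)⁻¹ * w.2.1,
            (timeScale t)⁻¹ * w.2.2) := by
  obtain ⟨C, c, hc, hexp⟩ := exists_exp_scaledExponent_le (κ := κ - ε) (by linarith)
  have hq : PolyFun fun θ k => k.1 ^ k₁ * (k.2.1 + σ * (θ.2.2 * k.1)) ^ k₂ * k.2.2 ^ k₃ :=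
    ((PolyFun.var₁.pow k₁).mul ((PolyFun.var₂.add
      ((PolyFun.const σ).mul (PolyFun.par₃.mul PolyFun.var₁))).pow k₂)).mul (PolyFun.var₃.pow k₃)
  obtain ⟨D, hD, hb⟩ := (polyFun_scaledExponent (κ - ε)).exists_norm_oscInt_le hc hexp hq
  refine ⟨D, hD, fun A t ht w => ?_⟩
  have hr := timeScale_pos ht
  have hρ := shearScale_pos A t
  have hb := hb _ (scaleParam_mem A t) ((timeScale t * shearScale A t)⁻¹ * w.1,
    (timeScale t)⁻¹ * w.2.1, (timeScale t)⁻¹ * w.2.2)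
  have hE := fun k => greenExponent_eq ht A κ ε k
  have hθ : (scaleParam A t).2.2 = A * t / shearScale A t := rfl
  set r := timeScale t
  set ρ := shearScale A t
  set q : R3 → R3 → ℝ := fun θ k => k.1 ^ k₁ * (k.2.1 + σ * (θ.2.2 * k.1)) ^ k₂ * k.2.2 ^ k₃
    with hqdef
  set F := polyExp (scaledExponent (κ - ε)) q (scaleParam A t)
  set M : ℝ := Real.exp (-ε * t) * (r ^ (k₁ + k₂ + k₃) * ρ ^ k₁)⁻¹ with hM
  have hM0 : 0 < M := by positivity
  have e : greenAmplitude A κ t σ k₁ k₂ k₃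
      = fun k => (M : ℂ) * F (r * ρ * k.1, r * k.2.1, r * k.2.2) := by
    funext k
    simp only [greenAmplitude, F, polyExp, greenHat₂_eq, hE k, Real.exp_add]
    rw [← Complex.ofReal_mul]
    congr 1
    have h2 : r * k.2.1 + σ * (A * t / ρ * (r * ρ * k.1)) = r * (k.2.1 + σ * (A * t * k.1)) := by
      field_simp
    simp only [hqdef, hθ, h2, mul_pow, hM]
    field_simp
    ring
  have e2 : oscInt (greenAmplitude A κ t σ k₁ k₂ k₃) w
      = (M : ℂ) * oscInt (fun k => F (r * ρ * k.1, r * k.2.1, r * k.2.2)) w := by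
    rw [e]
    unfold oscInt phaseIntegral
    rw [← integral_const_mul]
    refine integral_congr_ae (Eventually.of_forall fun k => ?_)
    simp only; ring
  rw [e2, oscInt_comp_diag (by positivity) hr hr, norm_mul, norm_mul, Complex.norm_real,
    Complex.norm_real, Real.norm_of_nonneg hM0.le, Real.norm_of_nonneg (by positivity)]
  calc _ ≤ M * ((r * ρ * r * r)⁻¹ * (D * weight ((r * ρ)⁻¹ * w.1, r⁻¹ * w.2.1, r⁻¹ * w.2.2))) := by
        gcongr
    _ = _ := by
      rw [hM, pow_add, pow_add ρ]
      field_simp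
      ring

/-! ### From pointwise bounds to L^p norms. -/

lemma weight_nonneg (w : R3) : 0 ≤ weight w := by unfold weight; positivity

lemma inv_one_add_sq_le_one (x : ℝ) : (1 + x ^ 2)⁻¹ ≤ 1 :=
  inv_le_one_of_one_le₀ (by nlinarith)

lemma weight_le_one (w : R3) : weight w ≤ 1 :=
  mul_le_one₀ (inv_one_add_sq_le_one _) (by positivity)
    (mul_le_one₀ (inv_one_add_sq_le_one _) (by positivity) (inv_one_add_sq_le_one _))

lemma integrable_weight : Integrable weight :=
  integrable_inv_one_add_sq.mul_prod
    (integrable_inv_one_add_sq.mul_prod integrable_inv_one_add_sq)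

lemma measurable_weight : Measurable weight := by unfold weight; fun_prop

/-- The argument `(x - x' - A t y', y - y', z - z')` of the kernels. -/
def relPos (A t : ℝ) (P P' : R3) : R3 :=
  (P.1 - P'.1 - A * t * P'.2.1, P.2.1 - P'.2.1, P.2.2 - P'.2.2)

lemma lintegral_relPos_left (A t : ℝ) (P' : R3) (f : R3 → ℝ≥0∞) :
    ∫⁻ P, f (relPos A t P P') = ∫⁻ w, f w := by
  rw [← lintegral_sub_right_eq_self f ((P'.1 + A * t * P'.2.1, P'.2.1, P'.2.2) : R3)]
  refine lintegral_congr fun P => ?_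
  simp only [relPos, Prod.sub_def, sub_sub]

/-- For fixed y', z' the shear is a translation in x'; removing it leaves the reflection P' ↦ P -
P'. -/
lemma lintegral_relPos_right (A t : ℝ) (P : R3) {f : R3 → ℝ≥0∞} (hf : Measurable f) :
    ∫⁻ P', f (relPos A t P P') = ∫⁻ w, f w := by
  have h1 : ∫⁻ P', f (relPos A t P P') = ∫⁻ P' : R3, f (P - P') := by
    have hv : (volume : Measure R3) = (volume : Measure ℝ).prod volume := rfl
    have hm : Measurable fun P' => f (relPos A t P P') := by
      refine hf.comp ?_
      unfold relPos
      fun_prop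
    have hm' : Measurable fun P' => f (P - P') := by fun_prop
    rw [hv, lintegral_prod_symm' _ hm, lintegral_prod_symm' _ hm']
    refine lintegral_congr fun y => ?_
    refine Eq.trans (lintegral_congr fun x => ?_)
      (lintegral_add_right_eq_self (fun x => f (P - (x, y))) (A * t * y.1))
    simp only [relPos, Prod.sub_def, sub_sub]
  rw [h1, lintegral_sub_left_eq_self]

/-- Since 0 ≤ g ≤ 1, g^q ≤ g for q ≥ 1, so one L¹ bound on g controls every exponent. -/
lemma eLpNorm_le_of_norm_le {f : R3 → ℂ} {g : R3 → ℝ} {N V : ℝ} (hN : 0 ≤ N) (hV : 0 ≤ V)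
    (hg0 : ∀ P, 0 ≤ g P) (hg1 : ∀ P, g P ≤ 1) (hf : ∀ P, ‖f P‖ ≤ N * g P)
    (hg : ∫⁻ P, ENNReal.ofReal (g P) ≤ ENNReal.ofReal V) {p : ℝ≥0∞} (hp : 1 ≤ p) :
    eLpNorm f p volume ≤ ENNReal.ofReal (N * V ^ (1 / p).toReal) := by
  rcases eq_or_ne p ∞ with rfl | hp'
  · rw [eLpNorm_exponent_top]
    simp only [ENNReal.div_top, ENNReal.toReal_zero, Real.rpow_zero, mul_one]
    refine eLpNormEssSup_le_of_ae_bound (Eventually.of_forall fun P => (hf P).trans ?_)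
    exact mul_le_of_le_one_right hN (hg1 P)
  · have hp0 : p ≠ 0 := (zero_lt_one.trans_le hp).ne'
    have hq1 : 1 ≤ p.toReal := by
      have := ENNReal.toReal_mono hp' hp
      simpa using this
    have hq0 : 0 < p.toReal := by linarith
    have hinv : (1 / p).toReal = 1 / p.toReal := by simp
    rw [eLpNorm_eq_lintegral_rpow_enorm_toReal hp0 hp', hinv]
    set q := p.toReal
    have hle : ∫⁻ P, ‖f P‖ₑ ^ q ≤ ENNReal.ofReal (N ^ q * V) := by
      calc ∫⁻ P, ‖f P‖ₑ ^ q ≤ ∫⁻ P, ENNReal.ofReal (N ^ q) * ENNReal.ofReal (g P) := by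
            refine lintegral_mono fun P => ?_
            rw [← ofReal_norm, ENNReal.ofReal_rpow_of_nonneg (norm_nonneg _) hq0.le,
              ← ENNReal.ofReal_mul (by positivity)]
            refine ENNReal.ofReal_le_ofReal ?_
            calc ‖f P‖ ^ q ≤ (N * g P) ^ q := Real.rpow_le_rpow (norm_nonneg _) (hf P) hq0.le
              _ = N ^ q * g P ^ q := Real.mul_rpow hN (hg0 P)
              _ ≤ N ^ q * g P := by
                refine mul_le_mul_of_nonneg_left ?_ (by positivity)
                simpa using Real.rpow_le_rpow_of_exponent_ge' (hg0 P) (hg1 P) zero_le_one hq1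
        _ = ENNReal.ofReal (N ^ q) * ∫⁻ P, ENNReal.ofReal (g P) :=
            lintegral_const_mul' _ _ ENNReal.ofReal_ne_top
        _ ≤ _ := by
            rw [ENNReal.ofReal_mul (by positivity)]
            gcongr
    calc _ ≤ ENNReal.ofReal (N ^ q * V) ^ (1 / q) := by gcongr
      _ = ENNReal.ofReal ((N ^ q * V) ^ (1 / q)) :=
        ENNReal.ofReal_rpow_of_nonneg (by positivity) (by positivity)
      _ = _ := by
        rw [Real.mul_rpow (by positivity) hV, ← Real.rpow_mul hN, mul_one_div_cancel hq0.ne',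
          Real.rpow_one]

/-! ### Derivatives of the Green's function as oscillatory integrals. -/

lemma gaussDecay_greenHat₂ {A κ t : ℝ} (hκ : 1 / 16 < κ) (ht : 0 < t) :
    GaussDecay (fun k => (greenHat₂ A κ t k : ℂ)) := by
  obtain ⟨c, hc, h⟩ := exists_greenExponent_le hκ
  simp only [greenHat₂_eq]
  refine ⟨?_, 1, c * t, by positivity, fun k => ?_⟩
  · unfold greenExponent
    fun_prop
  · rw [Complex.norm_real, Real.norm_eq_abs, Real.abs_exp, one_mul]
    exact Real.exp_le_exp.2 (h A t ht k)

lemma polyGrowth_greenHat₁ (A t : ℝ) (P' : R3) : PolyGrowth (greenHat₁ A t P') := by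
  unfold greenHat₁
  refine PolyGrowth.of_bounded (C := 1) (by fun_prop) fun k => ?_
  rw [neg_mul, ← mul_neg, ← Complex.ofReal_neg, norm_exp_I_mul_ofReal]

lemma polyGrowth_sheared (A t : ℝ) :
    PolyGrowth (fun k => ((k.2.1 + A * k.1 * t : ℝ) : ℂ)) := by
  have := PolyGrowth.snd.add ((((PolyGrowth.const A).mul PolyGrowth.fst)).mul (PolyGrowth.const t))
  simpa only [Complex.ofReal_add, Complex.ofReal_mul] using this

/-- The Fourier amplitude of `P ↦ greenFunction A κ t P P'`. -/
def greenSource (A κ t : ℝ) (P' k : R3) : ℂ :=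
  (((2 * Real.pi) ^ 3)⁻¹ : ℝ) * (greenHat₁ A t P' k * (greenHat₂ A κ t k : ℂ))

lemma gaussDecay_greenSource {A κ t : ℝ} (hκ : 1 / 16 < κ) (ht : 0 < t) (P' : R3) :
    GaussDecay (greenSource A κ t P') :=
  (PolyGrowth.const _).mul_gaussDecay
    ((polyGrowth_greenHat₁ A t P').mul_gaussDecay (gaussDecay_greenHat₂ hκ ht))

lemma greenFunction_eq_oscInt_greenSource (A κ t : ℝ) (P' : R3) :
    (fun P => greenFunction A κ t P P') = oscInt (greenSource A κ t P') := by
  funext P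
  unfold greenFunction oscInt phaseIntegral greenSource
  rw [← integral_const_mul]
  refine integral_congr_ae (Eventually.of_forall fun k => ?_)
  simp only; ring

lemma mixedDeriv_greenFunction_left {A κ t : ℝ} (hκ : 1 / 16 < κ) (ht : 0 < t) (k₁ k₂ k₃ : ℕ)
    (P P' : R3) :
    mixedDeriv k₁ k₂ k₃ (fun Q => greenFunction A κ t Q P') P
      = (((2 * Real.pi) ^ 3)⁻¹ : ℝ) * Complex.I ^ (k₁ + k₂ + k₃)
        * oscInt (greenAmplitude A κ t 0 k₁ k₂ k₃) (relPos A t P P') := by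
  rw [greenFunction_eq_oscInt_greenSource, mixedDeriv_phaseIntegral PolyGrowth.fst PolyGrowth.snd
    PolyGrowth.thd (gaussDecay_greenSource hκ ht P')]
  unfold oscInt phaseIntegral
  rw [← integral_const_mul]
  refine integral_congr_ae (Eventually.of_forall fun k => ?_)
  have e : Complex.exp (Complex.I * (((relPos A t P P').1 * k.1 + (relPos A t P P').2.1 * k.2.1
        + (relPos A t P P').2.2 * k.2.2 : ℝ) : ℂ))
      = Complex.exp (Complex.I * ((P.1 * k.1 + P.2.1 * k.2.1 + P.2.2 * k.2.2 : ℝ) : ℂ))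
        * greenHat₁ A t P' k := by
    rw [greenHat₁, ← Complex.exp_add]
    simp only [relPos]
    push_cast
    ring_nf
  simp only [e, greenSource, greenAmplitude]
  push_cast
  ring

/-- Differentiation in y' brings down η + Aξt, hence σ = 1 here, against σ = 0 for the unprimed
variables. -/
lemma mixedDeriv_greenFunction_right {A κ t : ℝ} (hκ : 1 / 16 < κ) (ht : 0 < t) (k₁ k₂ k₃ : ℕ)
    (P P' : R3) :
    mixedDeriv k₁ k₂ k₃ (fun Q' => greenFunction A κ t P Q') P'
      = (((2 * Real.pi) ^ 3)⁻¹ : ℝ) * (-Complex.I) ^ (k₁ + k₂ + k₃)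
        * oscInt (greenAmplitude A κ t 1 k₁ k₂ k₃) (relPos A t P P') := by
  set F : R3 → ℂ := fun k =>
    Complex.exp (Complex.I * ((P.1 * k.1 + P.2.1 * k.2.1 + P.2.2 * k.2.2 : ℝ) : ℂ))
      * ((((2 * Real.pi) ^ 3)⁻¹ : ℝ) * (greenHat₂ A κ t k : ℂ)) with hFdef
  have hF : GaussDecay F := (PolyGrowth.phase (by fun_prop)).mul_gaussDecay
    ((PolyGrowth.const _).mul_gaussDecay (gaussDecay_greenHat₂ hκ ht))
  have neg : ∀ {α : R3 → ℝ}, PolyGrowth (fun k => (α k : ℂ)) →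
      PolyGrowth (fun k => ((-α k : ℝ) : ℂ)) := fun h => by
    simpa using (PolyGrowth.const (-1)).mul h
  have e : (fun Q' => greenFunction A κ t P Q')
      = phaseIntegral (fun k => -k.1) (fun k => -(k.2.1 + A * k.1 * t)) (fun k => -k.2.2) F := by
    funext Q'
    unfold greenFunction phaseIntegral
    rw [← integral_const_mul]
    refine integral_congr_ae (Eventually.of_forall fun k => ?_)
    have : greenHat₁ A t Q' k = Complex.exp (Complex.I * ((Q'.1 * -k.1
        + Q'.2.1 * -(k.2.1 + A * k.1 * t) + Q'.2.2 * -k.2.2 : ℝ) : ℂ)) := by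
      rw [greenHat₁]; congr 1; push_cast; ring
    simp only [this, hFdef]
    ring
  rw [e, mixedDeriv_phaseIntegral (neg PolyGrowth.fst) (neg (polyGrowth_sheared A t))
    (neg PolyGrowth.thd) hF]
  unfold oscInt phaseIntegral
  rw [← integral_const_mul]
  refine integral_congr_ae (Eventually.of_forall fun k => ?_)
  have e1 : Complex.exp (Complex.I * (((relPos A t P P').1 * k.1 + (relPos A t P P').2.1 * k.2.1
        + (relPos A t P P').2.2 * k.2.2 : ℝ) : ℂ))
      = Complex.exp (Complex.I * ((P'.1 * -k.1 + P'.2.1 * -(k.2.1 + A * k.1 * t)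
          + P'.2.2 * -k.2.2 : ℝ) : ℂ))
        * Complex.exp (Complex.I * ((P.1 * k.1 + P.2.1 * k.2.1 + P.2.2 * k.2.2 : ℝ) : ℂ)) := by
    rw [← Complex.exp_add]
    simp only [relPos]
    push_cast
    ring_nf
  simp only [e1, hFdef, greenAmplitude]
  have e2 : ∀ x : ℝ, Complex.I * ((-x : ℝ) : ℂ) = -Complex.I * x := fun x => by push_cast; ring
  simp only [e2, mul_pow]
  push_cast
  ring

/-! ### The kernel norm estimates. -/

lemma kernelNorm_le {A t N : ℝ} (hN : 0 ≤ N) (ht : 0 < t) {K : R3 → R3 → ℂ}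
    (hK : ∀ P P', ‖K P P'‖ ≤ N * weight ((timeScale t * shearScale A t)⁻¹ * (relPos A t P P').1,
      (timeScale t)⁻¹ * (relPos A t P P').2.1, (timeScale t)⁻¹ * (relPos A t P P').2.2))
    {p : ℝ≥0∞} (hp : 1 ≤ p) :
    kernelNorm p K ≤ ENNReal.ofReal
      (N * (timeScale t ^ 3 * shearScale A t * ∫ w, weight w) ^ (1 / p).toReal) := by
  have hr := timeScale_pos ht
  have hρ := shearScale_pos A t
  set r := timeScale t
  set ρ := shearScale A t
  set g : R3 → ℝ := fun w => weight ((r * ρ)⁻¹ * w.1, r⁻¹ * w.2.1, r⁻¹ * w.2.2) with hg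
  have hgm : Measurable fun w => ENNReal.ofReal (g w) := by
    refine ENNReal.measurable_ofReal.comp (measurable_weight.comp ?_)
    fun_prop
  have hI : 0 ≤ ∫ w, weight w := integral_nonneg weight_nonneg
  have hint : ∫⁻ w, ENNReal.ofReal (g w) = ENNReal.ofReal (r ^ 3 * ρ * ∫ w, weight w) := by
    rw [lintegral_comp_diag (by positivity) (by positivity) (by positivity)
      (fun w => ENNReal.ofReal (weight w)),
      ← ofReal_integral_eq_lintegral_ofReal integrable_weight (Eventually.of_forall weight_nonneg),
      ← ENNReal.ofReal_mul (by positivity)]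
    congr 2
    field_simp
  refine max_le (iSup_le fun P => ?_) (iSup_le fun P' => ?_)
  · refine eLpNorm_le_of_norm_le (g := fun P' => g (relPos A t P P')) hN (by positivity)
      (fun _ => weight_nonneg _) (fun _ => weight_le_one _) (fun P' => hK P P') ?_ hp
    rw [lintegral_relPos_right A t P hgm, hint]
  · refine eLpNorm_le_of_norm_le (g := fun P => g (relPos A t P P')) hN (by positivity)
      (fun _ => weight_nonneg _) (fun _ => weight_le_one _) (fun P => hK P P') ?_ hp
    rw [lintegral_relPos_left A t P' (fun w => ENNReal.ofReal (g w)), hint]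

/-- The exponents of t and 1 + (At)⁴ add up to (-(3+k) + 3s)/4 and (-(1+k₁) + s)/4. The estimate V^s
≤ 1 + V makes the constant independent of p. -/
lemma scale_bound_le_decayBound {D V s ε A t : ℝ} {p : ℝ≥0∞} (hD : 0 ≤ D) (hV : 0 ≤ V)
    (hs : s = (1 / p).toReal) (hs1 : s ≤ 1) (ht : 0 < t) (k₁ k : ℕ) :
    D * Real.exp (-ε * t) * (timeScale t ^ (3 + k))⁻¹ * (shearScale A t ^ (1 + k₁))⁻¹
        * (timeScale t ^ 3 * shearScale A t * V) ^ s
      ≤ decayBound (D * (1 + V)) ε A t p k₁ k := by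
  have hs0 : 0 ≤ s := hs ▸ ENNReal.toReal_nonneg
  have hr := timeScale_pos ht
  have hρ := shearScale_pos A t
  have hb : 0 < 1 + (A * t) ^ 4 := by positivity
  have h1 : V ^ s ≤ 1 + V :=
    (Real.rpow_le_rpow hV (by linarith) hs0).trans
      ((Real.rpow_le_rpow_of_exponent_le (by linarith) hs1).trans_eq (Real.rpow_one _))
  have h2 : (timeScale t ^ (3 + k))⁻¹ * (timeScale t ^ 3) ^ s
      = t ^ (-(3 / 4 : ℝ) * (1 - s) - (k : ℝ) / 4) := by
    rw [timeScale, ← Real.rpow_natCast, ← Real.rpow_natCast, ← Real.rpow_mul ht.le,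
      ← Real.rpow_mul ht.le, ← Real.rpow_mul ht.le, ← Real.rpow_neg ht.le, ← Real.rpow_add ht]
    congr 1
    push_cast
    ring
  have h3 : (shearScale A t ^ (1 + k₁))⁻¹ * shearScale A t ^ s
      = (1 + (A * t) ^ 4) ^ (-(1 / 4 : ℝ) * (1 - s) - (k₁ : ℝ) / 4) := by
    rw [shearScale, ← Real.rpow_natCast, ← Real.rpow_mul hb.le, ← Real.rpow_mul hb.le,
      ← Real.rpow_neg hb.le, ← Real.rpow_add hb]
    congr 1
    push_cast
    ring
  rw [decayBound, ← hs, ← h2, ← h3, Real.mul_rpow (by positivity) hV,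
    Real.mul_rpow (by positivity) hρ.le]
  have h4 : 0 ≤ D * Real.exp (-ε * t) * ((timeScale t ^ (3 + k))⁻¹ * (timeScale t ^ 3) ^ s)
      * ((shearScale A t ^ (1 + k₁))⁻¹ * shearScale A t ^ s) := by positivity
  calc _ = D * Real.exp (-ε * t) * ((timeScale t ^ (3 + k))⁻¹ * (timeScale t ^ 3) ^ s)
      * ((shearScale A t ^ (1 + k₁))⁻¹ * shearScale A t ^ s) * V ^ s := by ring
    _ ≤ _ := mul_le_mul_of_nonneg_left h1 h4
    _ = _ := by ring

theorem exists_kernelNorm_le {ε κ : ℝ} (hε : 0 < ε) (hκ : 1 / 16 + ε < κ) :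
    ∃ C : ℝ, 0 < C ∧
      ∀ A : ℝ, ∀ k₁ k₂ k₃ : ℕ, k₁ + k₂ + k₃ ≤ 6 →
      ∀ p : ℝ≥0∞, 1 ≤ p → ∀ t : ℝ, 0 < t →
        kernelNorm p (fun P P' =>
            mixedDeriv k₁ k₂ k₃ (fun Q => greenFunction A κ t Q P') P)
          ≤ ENNReal.ofReal (decayBound C ε A t p k₁ (k₁ + k₂ + k₃)) ∧
        kernelNorm p (fun P P' =>
            mixedDeriv k₁ k₂ k₃ (fun Q' => greenFunction A κ t P Q') P')
          ≤ ENNReal.ofReal (decayBound C ε A t p k₁ (k₁ + k₂ + k₃)) := by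
  choose D hD hb using exists_norm_oscInt_greenAmplitude_le hκ
  set V := ∫ w, weight w
  have hV : 0 ≤ V := integral_nonneg weight_nonneg
  set E : ℝ → ℕ × ℕ × ℕ → ℝ := fun σ m => D σ m.1 m.2.1 m.2.2 with hE
  set T := Finset.range 7 ×ˢ Finset.range 7 ×ˢ Finset.range 7 with hT
  -- Summing the positive constants over a finite cube containing all admissible orders, for both σ,
  -- gives one constant for all.
  set M : ℝ := ∑ m ∈ T, (E 0 m + E 1 m) with hMdef
  have hE0 : ∀ σ m, 0 < E σ m := fun σ m => hD _ _ _ _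
  have hM : ∀ k₁ k₂ k₃ : ℕ, k₁ + k₂ + k₃ ≤ 6 → E 0 (k₁, k₂, k₃) + E 1 (k₁, k₂, k₃) ≤ M := by
    intro k₁ k₂ k₃ hk
    refine Finset.single_le_sum (f := fun m => E 0 m + E 1 m)
      (fun m _ => (add_pos (hE0 0 m) (hE0 1 m)).le) ?_
    simp only [hT, Finset.mem_product, Finset.mem_range]
    omega
  have hM0 : 0 < M := (add_pos (hE0 0 _) (hE0 1 _)).trans_le (hM 0 0 0 (by norm_num))
  set c₀ : ℝ := ((2 * Real.pi) ^ 3)⁻¹ with hc₀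
  have hc0 : 0 < c₀ := by positivity
  refine ⟨c₀ * M * (1 + V), by positivity, fun A k₁ k₂ k₃ hk p hp t ht => ?_⟩
  have hs1 : (1 / p).toReal ≤ 1 := by
    have h : 1 / p ≤ 1 := by simpa using hp
    simpa using ENNReal.toReal_mono ENNReal.one_ne_top h
  have hle := hM k₁ k₂ k₃ hk
  have hr := timeScale_pos ht
  have hρ := shearScale_pos A t
  have main : ∀ (σ : ℝ) (u : ℂ), ‖u‖ = 1 → D σ k₁ k₂ k₃ ≤ M → ∀ K : R3 → R3 → ℂ,
      (∀ P P', K P P' = (c₀ : ℂ) * u ^ (k₁ + k₂ + k₃)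
        * oscInt (greenAmplitude A κ t σ k₁ k₂ k₃) (relPos A t P P')) →
      kernelNorm p K ≤ ENNReal.ofReal
        (decayBound (c₀ * M * (1 + V)) ε A t p k₁ (k₁ + k₂ + k₃)) := by
    intro σ u hu hσ K hK
    refine (kernelNorm_le (A := A) (t := t) (N := c₀ * M * Real.exp (-ε * t)
      * (timeScale t ^ (3 + (k₁ + k₂ + k₃)))⁻¹ * (shearScale A t ^ (1 + k₁))⁻¹)
      (by positivity) ht (fun P P' => ?_) hp).trans
      (ENNReal.ofReal_le_ofReal (scale_bound_le_decayBound (by positivity) hV rfl hs1 ht _ _))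
    rw [hK, norm_mul, norm_mul, norm_pow, hu, one_pow, mul_one, Complex.norm_real,
      Real.norm_of_nonneg hc0.le]
    refine (mul_le_mul_of_nonneg_left (hb σ k₁ k₂ k₃ A t ht _) hc0.le).trans ?_
    have hw := weight_nonneg ((timeScale t * shearScale A t)⁻¹ * (relPos A t P P').1,
      (timeScale t)⁻¹ * (relPos A t P P').2.1, (timeScale t)⁻¹ * (relPos A t P P').2.2)
    simp only [← mul_assoc]
    gcongr
  have h0 := hE0 0 (k₁, k₂, k₃)
  have h1 := hE0 1 (k₁, k₂, k₃)
  simp only [hE] at hle h0 h1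
  have hκ' : 1 / 16 < κ := by linarith
  exact ⟨main 0 Complex.I (by simp) (by linarith) _
      fun P P' => mixedDeriv_greenFunction_left hκ' ht k₁ k₂ k₃ P P',
    main 1 (-Complex.I) (by simp) (by linarith) _
      fun P P' => mixedDeriv_greenFunction_right hκ' ht k₁ k₂ k₃ P P'⟩

/-! ### Smoothness. -/

lemma GaussDecay.integrable_norm_pow_mul {F : R3 → ℂ} (hF : GaussDecay F) (n : ℕ) :
    Integrable (fun k => ‖k‖ ^ n * ‖F k‖) := by
  have h : PolyGrowth (fun k : R3 => ((‖k‖ : ℝ) : ℂ)) := by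
    refine PolyGrowth.of_abs_le continuous_norm fun k => ?_
    have h1 := sq_nonneg k.1
    have h2 := sq_nonneg k.2.1
    have h3 := sq_nonneg k.2.2
    rw [Prod.norm_def, Prod.norm_def, sqNorm]
    simp only [Real.norm_eq_abs]
    rcases max_choice |k.1| (max |k.2.1| |k.2.2|) with h | h <;> rw [h]
    · rw [sq_abs]; linarith
    · rcases max_choice |k.2.1| |k.2.2| with h | h <;> rw [h, sq_abs] <;> linarith
  refine ((h.pow n).mul_gaussDecay hF).integrable.norm.congr (Eventually.of_forall fun k => ?_)
  simp

lemma contDiff_oscInt {F : R3 → ℂ} (hF : GaussDecay F) : ContDiff ℝ ∞ (oscInt F) := by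
  let f₁ : R3 →L[ℝ] ℝ := ContinuousLinearMap.fst ℝ ℝ (ℝ × ℝ)
  let f₂ : R3 →L[ℝ] ℝ :=
    (ContinuousLinearMap.fst ℝ ℝ ℝ).comp (ContinuousLinearMap.snd ℝ ℝ (ℝ × ℝ))
  let f₃ : R3 →L[ℝ] ℝ :=
    (ContinuousLinearMap.snd ℝ ℝ ℝ).comp (ContinuousLinearMap.snd ℝ ℝ (ℝ × ℝ))
  let M := ContinuousLinearMap.mul ℝ ℝ
  -- The Fourier kernel is exp(-2πi L(k, w)), so -1/(2π) times the dot product reproduces exp(i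
  -- w·k).
  let L : R3 →L[ℝ] R3 →L[ℝ] ℝ := (-(2 * Real.pi)⁻¹) •
    (M.bilinearComp f₁ f₁ + M.bilinearComp f₂ f₂ + M.bilinearComp f₃ f₃)
  have h := VectorFourier.contDiff_fourierIntegral (μ := (volume : Measure R3)) L (f := F)
    (N := ⊤) (fun n _ => hF.integrable_norm_pow_mul n)
  have e : oscInt F = VectorFourier.fourierIntegral Real.fourierChar volume L.toLinearMap₁₂ F := by
    funext w
    refine integral_congr_ae (Eventually.of_forall fun k => ?_)
    simp only [Circle.smul_def, Real.fourierChar_apply, smul_eq_mul]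
    congr 2
    have : L.toLinearMap₁₂ k w = -(2 * Real.pi)⁻¹ * (k.1 * w.1 + k.2.1 * w.2.1 + k.2.2 * w.2.2) :=
      rfl
    rw [this]
    have hpi : (Real.pi : ℂ) ≠ 0 := by exact_mod_cast Real.pi_ne_zero
    push_cast
    field_simp
  rw [e]
  exact h

lemma greenFunction_eq_oscInt {A κ t : ℝ} (hκ : 1 / 16 < κ) (ht : 0 < t) (P P' : R3) :
    greenFunction A κ t P P' = (((2 * Real.pi) ^ 3)⁻¹ : ℝ)
      * oscInt (fun k => (greenHat₂ A κ t k : ℂ)) (relPos A t P P') := by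
  have h := mixedDeriv_greenFunction_left (A := A) hκ ht 0 0 0 P P'
  have e : greenAmplitude A κ t 0 0 0 0 = fun k => (greenHat₂ A κ t k : ℂ) := by
    funext k
    simp [greenAmplitude]
  rw [e] at h
  simpa [mixedDeriv] using h

lemma contDiff_greenFunction {A κ t : ℝ} (hκ : 1 / 16 < κ) (ht : 0 < t) :
    ContDiff ℝ ∞ (fun q : R3 × R3 => greenFunction A κ t q.1 q.2) := by
  simp only [greenFunction_eq_oscInt hκ ht]
  refine contDiff_const.mul ((contDiff_oscInt (gaussDecay_greenHat₂ hκ ht)).comp ?_)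
  unfold relPos
  fun_prop

/-! ### The evolution equation. -/

lemma oscInt_add {F G : R3 → ℂ} (hF : Integrable F) (hG : Integrable G) (w : R3) :
    oscInt (fun k => F k + G k) w = oscInt F w + oscInt G w := by
  have hE : ∀ F : R3 → ℂ, Integrable F →
      Integrable fun k => Complex.exp (Complex.I * (dot w k : ℂ)) * F k := fun F hF =>
    hF.bdd_mul (c := 1) (PolyGrowth.phase (continuous_dot w)).continuous.aestronglyMeasurable
      (Eventually.of_forall fun k => (norm_exp_I_mul_ofReal _).le)
  refine Eq.trans ?_ (integral_add (hE F hF) (hE G hG))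
  refine integral_congr_ae (Eventually.of_forall fun k => ?_)
  simp only
  exact mul_add _ _ _

lemma integrable_fun_add {F G : R3 → ℂ} (hF : Integrable F) (hG : Integrable G) :
    Integrable (fun k => F k + G k) := hF.add hG

lemma oscInt_const_mul (c : ℂ) (F : R3 → ℂ) (w : R3) :
    oscInt (fun k => c * F k) w = c * oscInt F w := by
  unfold oscInt phaseIntegral
  rw [← integral_const_mul]
  refine integral_congr_ae (Eventually.of_forall fun k => ?_)
  simp only; ring

lemma laplacian_oscInt {F : R3 → ℂ} (hF : GaussDecay F) :
    laplacian (oscInt F) = oscInt (fun k => -(sqNorm k : ℂ) * F k) := by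
  have m := mixedDeriv_phaseIntegral PolyGrowth.fst PolyGrowth.snd PolyGrowth.thd hF
  have hI := PolyGrowth.const Complex.I
  have i₁ := (((hI.mul PolyGrowth.fst).pow 2).mul_gaussDecay hF).integrable
  have i₂ := (((hI.mul PolyGrowth.snd).pow 2).mul_gaussDecay hF).integrable
  have i₃ := (((hI.mul PolyGrowth.thd).pow 2).mul_gaussDecay hF).integrable
  funext w
  simp only [laplacian, m, pow_zero, one_mul]
  refine ((congrArg₂ _ (oscInt_add i₁ i₂ w).symm rfl).trans
    (oscInt_add (i₁.add i₂) i₃ w).symm).trans ?_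
  congr 1
  funext k
  simp only [Pi.add_apply, sqNorm, mul_pow, Complex.I_sq]
  push_cast
  ring

lemma polyGrowth_sqNorm : PolyGrowth (fun k => (sqNorm k : ℂ)) := by
  have := ((PolyGrowth.fst.pow 2).add (PolyGrowth.snd.pow 2)).add (PolyGrowth.thd.pow 2)
  simpa only [sqNorm, Complex.ofReal_add, Complex.ofReal_pow] using this

lemma polyGrowth_shearSymbol (A t : ℝ) : PolyGrowth (fun k => (shearSymbol A t k : ℂ)) := by
  have := ((PolyGrowth.fst.pow 2).add ((polyGrowth_sheared A t).pow 2)).add (PolyGrowth.thd.pow 2)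
  simpa only [shearSymbol, Complex.ofReal_add, Complex.ofReal_pow] using this

/-- The logarithmic time derivative of the Fourier amplitude of the Green's function. -/
def greenRate (A κ t : ℝ) (P' k : R3) : ℂ :=
  -Complex.I * (P'.2.1 * (A * k.1)) + shearSymbol A t k - κ - 4 * shearSymbol A t k ^ 2

lemma hasDerivAt_greenSource (A κ : ℝ) (P' k : R3) (t : ℝ) :
    HasDerivAt (fun s => greenSource A κ s P' k)
      (greenRate A κ t P' k * greenSource A κ t P' k) t := by
  have h1 : HasDerivAt (fun s : ℝ => P'.1 * k.1 + P'.2.1 * (k.2.1 + A * k.1 * s) + P'.2.2 * k.2.2)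
      (P'.2.1 * (A * k.1)) t := by
    have := ((((hasDerivAt_id t).const_mul (A * k.1)).const_add k.2.1).const_mul P'.2.1).const_add
      (P'.1 * k.1) |>.add_const (P'.2.2 * k.2.2)
    simpa using this
  have h2 := (h1.ofReal_comp.const_mul (-Complex.I)).cexp
  have h3 := (hasDerivAt_greenExponent A κ k t).exp.ofReal_comp
  refine ((h2.mul h3).const_mul ((((2 * Real.pi) ^ 3)⁻¹ : ℝ) : ℂ)).congr_of_eventuallyEq
    (Eventually.of_forall fun s => ?_) |>.congr_deriv ?_
  · simp only [greenSource, greenHat₁, greenHat₂_eq, Pi.mul_apply]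
  · simp only [greenSource, greenHat₁, greenHat₂_eq, greenRate]
    push_cast
    ring

/-- As v(s) depends on s through η + Aξs, Aξ∂_η of ∫₀ᵗ (v - 4v²) ds is v - 4v² at s = t minus its
value at s = 0, where v = |k|². The source phase adds -iy'Aξ. -/
lemma hasLineDerivAt_greenSource (A κ t : ℝ) (P' k : R3) :
    HasLineDerivAt ℝ (fun k : R3 => (A * (Complex.I * k.1)) * greenSource A κ t P' k)
      (Complex.I * ((greenRate A κ t P' k + κ - sqNorm k + 4 * sqNorm k ^ 2)
        * greenSource A κ t P' k)) k (0, 1, 0) := by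
  have h0 : HasDerivAt (fun s : ℝ => k.2.1 + s) 1 0 := (hasDerivAt_id (0 : ℝ)).const_add _
  have h1 : HasDerivAt (fun s : ℝ => P'.1 * k.1 + P'.2.1 * (k.2.1 + s + A * k.1 * t)
      + P'.2.2 * k.2.2) P'.2.1 0 := by
    have := (((h0.add_const (A * k.1 * t)).const_mul P'.2.1).const_add (P'.1 * k.1)).add_const
      (P'.2.2 * k.2.2)
    simpa using this
  have h2 := (h1.ofReal_comp.const_mul (-Complex.I)).cexp
  set x := A * k.1 with hx
  set B := k.1 ^ 2 + k.2.2 ^ 2 with hB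
  have hm₁ := (((h0.pow 2).mul_const t).add (h0.mul_const (x * t ^ 2))).mul_const (1 - 8 * B)
  have hm₂ := (((((h0.pow 4).mul_const t).add ((h0.pow 3).mul_const (2 * x * t ^ 2))).add
    ((h0.pow 2).mul_const (2 * x ^ 2 * t ^ 3))).add (h0.mul_const (x ^ 3 * t ^ 4))).const_mul 4
  have h3 := ((hm₁.sub hm₂).const_add (B * t + x ^ 2 * t ^ 3 / 3 * (1 - 8 * B) - κ * t
    - 4 * (B ^ 2 * t + x ^ 4 * t ^ 5 / 5))).exp.ofReal_comp
  have h4 := (h2.mul h3).const_mul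
    ((A * (Complex.I * k.1)) * ((((2 * Real.pi) ^ 3)⁻¹ : ℝ) : ℂ))
  have e : ∀ s : ℝ, greenExponent A κ t (k + s • ((0, 1, 0) : R3)) = (B * t
      + x ^ 2 * t ^ 3 / 3 * (1 - 8 * B) - κ * t - 4 * (B ^ 2 * t + x ^ 4 * t ^ 5 / 5))
      + (((k.2.1 + s) ^ 2 * t + (k.2.1 + s) * (x * t ^ 2)) * (1 - 8 * B)
      - 4 * ((k.2.1 + s) ^ 4 * t + (k.2.1 + s) ^ 3 * (2 * x * t ^ 2)
        + (k.2.1 + s) ^ 2 * (2 * x ^ 2 * t ^ 3) + (k.2.1 + s) * (x ^ 3 * t ^ 4))) := by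
    intro s
    simp only [greenExponent, Prod.fst_add, Prod.snd_add, Prod.smul_fst, Prod.smul_snd, smul_eq_mul,
      mul_zero, mul_one, add_zero, hx, hB]
    ring
  have e0 := e 0
  rw [zero_smul, add_zero] at e0
  refine (h4.congr_of_eventuallyEq (Eventually.of_forall fun s => ?_)).congr_deriv ?_
  · simp only [greenSource, greenHat₁, greenHat₂_eq, e, Pi.mul_apply, Pi.add_apply, Pi.sub_apply,
      Pi.pow_apply, Prod.fst_add, Prod.snd_add, Prod.smul_fst, Prod.smul_snd, smul_eq_mul, mul_zero,
      mul_one, add_zero]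
    ring
  · simp only [greenSource, greenHat₁, greenHat₂_eq, e0, greenRate, Pi.add_apply,
      Pi.sub_apply, Pi.pow_apply, shearSymbol, sqNorm, hx, hB, add_zero]
    push_cast
    ring

lemma polyGrowth_greenRate (A κ t : ℝ) (P' : R3) : PolyGrowth (greenRate A κ t P') := by
  have h := ((((PolyGrowth.const (-Complex.I)).mul ((PolyGrowth.const P'.2.1).mul
    ((PolyGrowth.const A).mul PolyGrowth.fst))).add (polyGrowth_shearSymbol A t)).add
    (PolyGrowth.const (-κ))).add
    ((PolyGrowth.const (-4)).mul ((polyGrowth_shearSymbol A t).pow 2))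
  convert h using 2 with k
  simp only [greenRate]
  ring

/-- The term Ay∂_x contributes minus the rate, minus κ, plus |k|² - 4|k|⁴ to the amplitude; the last
three cancel against κ + Δ + 4Δ². -/
lemma neg_spatialOp_greenFunction {A κ t : ℝ} (hκ : 1 / 16 < κ) (ht : 0 < t) (P P' : R3) :
    -spatialOp A κ (fun Q => greenFunction A κ t Q P') P
      = oscInt (fun k => greenRate A κ t P' k * greenSource A κ t P' k) P := by
  have hS := gaussDecay_greenSource (A := A) hκ ht P'
  have hn := polyGrowth_sqNorm
  have hn' : PolyGrowth (fun k => -(sqNorm k : ℂ)) := by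
    simpa using (PolyGrowth.const (-1)).mul hn
  have hR := polyGrowth_greenRate A κ t P'
  have hF : GaussDecay (fun k : R3 => (A * (Complex.I * k.1)) * greenSource A κ t P' k) :=
    ((PolyGrowth.const _).mul ((PolyGrowth.const _).mul PolyGrowth.fst)).mul_gaussDecay hS
  have hQ : PolyGrowth (fun k => greenRate A κ t P' k + κ - sqNorm k + 4 * sqNorm k ^ 2) := by
    have := ((hR.add (PolyGrowth.const κ)).add hn').add ((PolyGrowth.const 4).mul (hn.pow 2))
    simpa only [← sub_eq_add_neg] using this
  have hF' := (PolyGrowth.const Complex.I).mul_gaussDecay (hQ.mul_gaussDecay hS)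
  have key := dot_mul_oscInt hF hF' (fun k => hasLineDerivAt_greenSource A κ t P' k) P
  have hd : dot P (0, 1, 0) = P.2.1 := by simp [dot]
  have hx : (A : ℂ) * mixedDeriv 1 0 0 (oscInt (greenSource A κ t P')) P
      = oscInt (fun k : R3 => (A * (Complex.I * k.1)) * greenSource A κ t P' k) P := by
    rw [mixedDeriv_phaseIntegral PolyGrowth.fst PolyGrowth.snd PolyGrowth.thd hS]
    refine (oscInt_const_mul _ _ P).symm.trans ?_
    congr 1
    funext k
    simp only [pow_one, pow_zero, one_mul]
    ring
  rw [hd] at key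
  rw [greenFunction_eq_oscInt_greenSource, spatialOp, laplacian_oscInt hS,
    laplacian_oscInt (hn'.mul_gaussDecay hS), mul_right_comm, hx, mul_comm _ (P.2.1 : ℂ), key]
  have i₁ := hF'.integrable.const_mul Complex.I
  have i₂ := (hn'.mul_gaussDecay hS).integrable
  have i₃ := (hn'.mul_gaussDecay (hn'.mul_gaussDecay hS)).integrable.const_mul 4
  have i₄ := hS.integrable.const_mul (κ : ℂ)
  have i₁₂ := integrable_fun_add i₁ i₂
  rw [← oscInt_const_mul, ← oscInt_const_mul, ← oscInt_const_mul, ← oscInt_add i₁ i₂,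
    ← oscInt_add i₁₂ i₃, ← oscInt_add (integrable_fun_add i₁₂ i₃) i₄, neg_eq_neg_one_mul, ← oscInt_const_mul]
  congr 1
  funext k
  linear_combination (-((greenRate A κ t P' k + κ - sqNorm k + 4 * sqNorm k ^ 2)
    * greenSource A κ t P' k)) * Complex.I_mul_I

lemma norm_greenRate_le {A κ t : ℝ} {s : ℝ} (hs : |s - t| < t / 2) (P' k : R3) :
    ‖greenRate A κ s P' k‖ ≤ (|P'.2.1 * A| + (2 + 5 * (A * t) ^ 2) + |κ|
      + 4 * (2 + 5 * (A * t) ^ 2) ^ 2) * (1 + sqNorm k) ^ 2 := by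
  have hn := sqNorm_nonneg k
  obtain ⟨hs1, hs2⟩ := abs_lt.1 hs
  have hst : s ^ 2 ≤ 9 / 4 * t ^ 2 := by nlinarith
  -- (η + Aξs)² ≤ 2η² + 2(Aξs)² and s² ≤ 9t²/4 give the coefficient 9/2 ≤ 5.
  set K := 2 + 5 * (A * t) ^ 2 with hK
  have hK0 : 0 < K := by positivity
  have hv0 : 0 ≤ shearSymbol A s k := by unfold shearSymbol; positivity
  have hv : shearSymbol A s k ≤ K * sqNorm k := by
    have h1 : (A * k.1 * s) ^ 2 ≤ 9 / 4 * (A * t) ^ 2 * k.1 ^ 2 := by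
      calc (A * k.1 * s) ^ 2 = (A * k.1) ^ 2 * s ^ 2 := by ring
        _ ≤ (A * k.1) ^ 2 * (9 / 4 * t ^ 2) := by gcongr
        _ = _ := by ring
    simp only [shearSymbol, sqNorm, hK]
    nlinarith [sq_nonneg (k.2.1 - A * k.1 * s), mul_nonneg (sq_nonneg (A * t)) (sq_nonneg k.1),
      mul_nonneg (sq_nonneg (A * t)) (sq_nonneg k.2.1),
      mul_nonneg (sq_nonneg (A * t)) (sq_nonneg k.2.2), sq_nonneg k.1, sq_nonneg k.2.2]
  have hξ : |k.1| ≤ 1 + sqNorm k := by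
    rw [sqNorm, abs_le]
    constructor <;> nlinarith [sq_nonneg (k.1 - 1), sq_nonneg (k.1 + 1), sq_nonneg k.2.1,
      sq_nonneg k.2.2]
  have h1 : ‖-Complex.I * (P'.2.1 * (A * k.1))‖ ≤ |P'.2.1 * A| * (1 + sqNorm k) := by
    have : ‖-Complex.I * (P'.2.1 * (A * k.1))‖ = |P'.2.1 * A| * |k.1| := by
      simp [abs_mul, mul_assoc]
    rw [this]
    gcongr
  have h2 : ‖(shearSymbol A s k : ℂ)‖ ≤ K * sqNorm k := by
    rwa [Complex.norm_real, Real.norm_of_nonneg hv0]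
  have h3 : ‖(4 : ℂ) * (shearSymbol A s k : ℂ) ^ 2‖ ≤ 4 * (K * sqNorm k) ^ 2 := by
    rw [norm_mul, norm_pow]
    norm_num only [Complex.norm_ofNat]
    gcongr
  have h4 : ‖(κ : ℂ)‖ = |κ| := by rw [Complex.norm_real, Real.norm_eq_abs]
  have h5 : ‖greenRate A κ s P' k‖ ≤ |P'.2.1 * A| * (1 + sqNorm k) + K * sqNorm k + |κ|
      + 4 * (K * sqNorm k) ^ 2 := by
    unfold greenRate
    refine (norm_sub_le _ _).trans (add_le_add ((norm_sub_le _ _).trans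
      (add_le_add ((norm_add_le _ _).trans (add_le_add h1 h2)) h4.le)) h3)
  refine h5.trans ?_
  have hP := abs_nonneg (P'.2.1 * A)
  have hk := abs_nonneg κ
  nlinarith [mul_nonneg hP hn, mul_nonneg hk hn, mul_nonneg hK0.le hn, sq_nonneg (K * sqNorm k),
    mul_nonneg hP (sq_nonneg (sqNorm k)), mul_nonneg hk (sq_nonneg (sqNorm k)),
    mul_nonneg hK0.le (sq_nonneg (sqNorm k)), mul_nonneg (sq_nonneg K) hn, sq_nonneg K]

lemma norm_greenSource (A κ t : ℝ) (P' k : R3) :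
    ‖greenSource A κ t P' k‖ = ((2 * Real.pi) ^ 3)⁻¹ * Real.exp (greenExponent A κ t k) := by
  rw [greenSource, norm_mul, norm_mul, Complex.norm_real, Complex.norm_real, greenHat₂_eq,
    Real.norm_of_nonneg (by positivity), Real.norm_of_nonneg (by positivity), greenHat₁, neg_mul,
    ← mul_neg, ← Complex.ofReal_neg, norm_exp_I_mul_ofReal, one_mul]

/-- For |s - t| < t/2 the exponent is at most -(ct/2)|k|². Half of that rate absorbs the growth (1 +
|k|²)² of the time derivative, and the other half is an integrable majorant. -/
lemma hasDerivAt_greenFunction {A κ t : ℝ} (hκ : 1 / 16 < κ) (ht : 0 < t) (P P' : R3) :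
    HasDerivAt (fun s => greenFunction A κ s P P')
      (oscInt (fun k => greenRate A κ t P' k * greenSource A κ t P' k) P) t := by
  have e : (fun s => greenFunction A κ s P P') = fun s => oscInt (greenSource A κ s P') P := by
    funext s
    exact congrFun (greenFunction_eq_oscInt_greenSource A κ s P') P
  rw [e]
  obtain ⟨c, hc, hexp⟩ := exists_greenExponent_le hκ
  have hct : 0 < c * t / 4 := by positivity
  obtain ⟨M, hM, hMb⟩ := exists_one_add_pow_le_exp 2 hct
  set R := |P'.2.1 * A| + (2 + 5 * (A * t) ^ 2) + |κ| + 4 * (2 + 5 * (A * t) ^ 2) ^ 2 with hRdef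
  have hR : 0 ≤ R := by positivity
  have hE : PolyGrowth (fun k : R3 => Complex.exp (Complex.I *
      ((P.1 * k.1 + P.2.1 * k.2.1 + P.2.2 * k.2.2 : ℝ) : ℂ))) := PolyGrowth.phase (by fun_prop)
  unfold oscInt phaseIntegral
  refine (hasDerivAt_integral_of_dominated_loc_of_deriv_le
    (F := fun (s : ℝ) (k : R3) => Complex.exp (Complex.I *
      ((P.1 * k.1 + P.2.1 * k.2.1 + P.2.2 * k.2.2 : ℝ) : ℂ)) * greenSource A κ s P' k)
    (F' := fun (s : ℝ) (k : R3) => Complex.exp (Complex.I *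
      ((P.1 * k.1 + P.2.1 * k.2.1 + P.2.2 * k.2.2 : ℝ) : ℂ))
        * (greenRate A κ s P' k * greenSource A κ s P' k))
    (bound := fun k => R * M * ((2 * Real.pi) ^ 3)⁻¹ * Real.exp (-(c * t / 4) * sqNorm k))
    (s := Metric.ball t (t / 2)) (Metric.ball_mem_nhds t (by positivity))
    ?_ ?_ ?_ ?_ ?_ ?_).2
  · filter_upwards [lt_mem_nhds ht] with s hs
    exact (hE.mul_gaussDecay (gaussDecay_greenSource hκ hs P')).continuous.aestronglyMeasurable
  · exact (hE.mul_gaussDecay (gaussDecay_greenSource hκ ht P')).integrable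
  · exact (hE.mul_gaussDecay ((polyGrowth_greenRate A κ t P').mul_gaussDecay
      (gaussDecay_greenSource hκ ht P'))).continuous.aestronglyMeasurable
  · refine Eventually.of_forall fun k s hs => ?_
    rw [Metric.mem_ball, Real.dist_eq] at hs
    have hs0 : t / 2 < s := by linarith [(abs_lt.1 hs).1]
    have hn := sqNorm_nonneg k
    rw [norm_mul, norm_exp_I_mul_ofReal, one_mul, norm_mul, norm_greenSource]
    have h1 : greenExponent A κ s k ≤ -(c * t / 2) * sqNorm k := by
      refine (hexp A s (by linarith) k).trans ?_
      nlinarith [mul_nonneg hc.le hn]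
    calc _ ≤ (R * (M * Real.exp (c * t / 4 * sqNorm k)))
          * (((2 * Real.pi) ^ 3)⁻¹ * Real.exp (-(c * t / 2) * sqNorm k)) := by
          refine mul_le_mul ((norm_greenRate_le hs P' k).trans
            (mul_le_mul_of_nonneg_left (hMb _ hn) hR)) ?_ (by positivity) (by positivity)
          gcongr
      _ = R * M * ((2 * Real.pi) ^ 3)⁻¹ *
          (Real.exp (c * t / 4 * sqNorm k) * Real.exp (-(c * t / 2) * sqNorm k)) := by ring
      _ = _ := by rw [← Real.exp_add]; congr 2; ring
  · exact (integrable_exp_neg_sqNorm hct).const_mul _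
  · exact Eventually.of_forall fun k s _ => (hasDerivAt_greenSource A κ P' k s).const_mul _

/-! ### Fourier inversion and the initial value. -/

/-- `R3` with its Euclidean inner product. -/
abbrev E3 : Type := WithLp 2 (ℝ × WithLp 2 (ℝ × ℝ))

/-- The identification of `E3` with `R3`. -/
def E3.toR3 (v : E3) : R3 := (v.fst, v.snd.fst, v.snd.snd)

lemma E3.continuous_toR3 : Continuous E3.toR3 := by unfold E3.toR3; fun_prop

lemma E3.measurePreserving_toR3 : MeasurePreserving E3.toR3 :=
  ((MeasurePreserving.id (volume : Measure ℝ)).prod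
    (WithLp.volume_preserving_ofLp ℝ ℝ)).comp
      (WithLp.volume_preserving_ofLp ℝ (WithLp 2 (ℝ × ℝ)))

lemma E3.measurableEmbedding_toR3 : MeasurableEmbedding E3.toR3 := by
  refine E3.continuous_toR3.measurableEmbedding fun v w h => ?_
  simp only [E3.toR3, Prod.mk.injEq] at h
  refine WithLp.ofLp_injective 2 (Prod.ext h.1 (WithLp.ofLp_injective 2 (Prod.ext h.2.1 h.2.2)))

/-- Fourier inversion at the origin. It is applied on the inner product space `E3`, where the
transform at v is `oscInt` at -2πv; the dilation accounts for (2π)⁻³. -/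
lemma integral_oscInt {F : R3 → ℂ} (hF : GaussDecay F) (hF' : Integrable (oscInt F)) :
    (((2 * Real.pi) ^ 3)⁻¹ : ℝ) * ∫ w, oscInt F w = F 0 := by
  have hpi : -(2 * Real.pi) ≠ 0 := by simp [Real.pi_ne_zero]
  have hf : 𝓕 (F ∘ E3.toR3) = (fun w => oscInt F ((-(2 * Real.pi)) • w)) ∘ E3.toR3 := by
    funext v
    rw [Real.fourier_eq', Function.comp_apply]
    refine Eq.trans ?_ (E3.measurePreserving_toR3.integral_comp E3.measurableEmbedding_toR3 _)
    refine integral_congr_ae (Eventually.of_forall fun k => ?_)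
    simp only [Function.comp_apply, smul_eq_mul, E3.toR3, WithLp.prod_inner_apply, Prod.smul_fst,
      Prod.smul_snd]
    congr 2
    simp
    ring
  have hi : Integrable (𝓕 (F ∘ E3.toR3)) := by
    rw [hf]
    exact (E3.measurePreserving_toR3.integrable_comp_emb E3.measurableEmbedding_toR3).2
      (hF'.comp_smul hpi)
  have inv := congrFun ((hF.continuous.comp E3.continuous_toR3).fourierInv_fourier_eq
    ((E3.measurePreserving_toR3.integrable_comp_emb E3.measurableEmbedding_toR3).2 hF.integrable)
    hi) 0
  rw [Real.fourierInv_eq', hf] at inv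
  simp only [inner_zero_right, mul_zero, Complex.ofReal_zero, zero_mul, Complex.exp_zero,
    one_smul] at inv
  have h2 := E3.measurePreserving_toR3.integral_comp E3.measurableEmbedding_toR3
    (fun w => oscInt F ((-(2 * Real.pi)) • w))
  have h3 := Measure.integral_comp_smul (volume : Measure R3) (oscInt F) (-(2 * Real.pi))
  simp only [Function.comp_apply] at inv
  rw [h2, h3] at inv
  have hd : Module.finrank ℝ R3 = 3 := by simp
  have h0 : E3.toR3 0 = 0 := rfl
  rw [hd, h0, Complex.real_smul] at inv
  rw [← inv]
  congr 3
  rw [abs_inv, abs_pow, abs_neg, abs_of_pos (by positivity)]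

/-- The Green's function in the variables rescaled by `t^{1/4}`. -/
def rescaledKernel (A κ t : ℝ) (u : R3) : ℂ :=
  (timeScale t ^ 3 * ((2 * Real.pi) ^ 3)⁻¹ : ℝ) * oscInt (fun k => (greenHat₂ A κ t k : ℂ))
    (timeScale t * u.1, timeScale t * u.2.1, timeScale t * u.2.2)

lemma continuous_rescaledKernel {A κ t : ℝ} (hκ : 1 / 16 < κ) (ht : 0 < t) :
    Continuous (rescaledKernel A κ t) :=
  continuous_const.mul ((contDiff_oscInt (gaussDecay_greenHat₂ hκ ht)).continuous.comp
    (by fun_prop))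

lemma weight_div_le {ρ : ℝ} (hρ : 1 ≤ ρ) (u : R3) :
    weight (ρ⁻¹ * u.1, u.2.1, u.2.2) ≤ ρ ^ 2 * weight u := by
  have h : (1 + (ρ⁻¹ * u.1) ^ 2)⁻¹ ≤ ρ ^ 2 * (1 + u.1 ^ 2)⁻¹ := by
    have hρ2 : 1 ≤ ρ ^ 2 := one_le_pow₀ hρ
    rw [← div_eq_mul_inv, inv_eq_one_div, div_le_div_iff₀ (by positivity) (by positivity)]
    have : ρ ^ 2 * (1 + (ρ⁻¹ * u.1) ^ 2) = ρ ^ 2 + u.1 ^ 2 := by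
      field_simp
    linarith
  refine (mul_le_mul_of_nonneg_right h ?_).trans_eq (mul_assoc _ _ _)
  simp only
  positivity

/-- While At ≤ 1 the shear factor ρ is at most 2. Deforming the weight costs ρ², the kernel bound
has ρ⁻¹, and the remaining ρ goes into the constant. -/
lemma exists_norm_rescaledKernel_le {κ : ℝ} (hκ : 1 / 16 < κ) {A : ℝ} (hA : 0 < A) :
    ∃ D, 0 < D ∧ ∀ t, 0 < t → A * t ≤ 1 → ∀ u, ‖rescaledKernel A κ t u‖ ≤ D * weight u := by
  obtain ⟨D, hD, h⟩ := exists_norm_oscInt_greenAmplitude_le (ε := 0)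
    ((add_zero _).trans_lt hκ) 0 0 0 0
  refine ⟨((2 * Real.pi) ^ 3)⁻¹ * D * 2, by positivity, fun t ht hAt u => ?_⟩
  have hr := timeScale_pos ht
  have h1 := one_le_shearScale A t
  have hρ := shearScale_pos A t
  have h4 := shearScale_pow A t
  have h := h A t ht (timeScale t * u.1, timeScale t * u.2.1, timeScale t * u.2.2)
  have e : greenAmplitude A κ t 0 0 0 0 = fun k => (greenHat₂ A κ t k : ℂ) := by
    funext k
    simp [greenAmplitude]
  rw [e] at h
  have hρ2 : shearScale A t ≤ 2 := by
    have : (A * t) ^ 4 ≤ 1 := pow_le_one₀ (by positivity) hAt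
    by_contra hlt
    push Not at hlt
    have := pow_le_pow_left₀ (by norm_num) hlt.le 4
    linarith
  have hw := weight_div_le h1 u
  set r := timeScale t
  set ρ := shearScale A t
  have ew : (((r * ρ)⁻¹ * (r * u.1), r⁻¹ * (r * u.2.1), r⁻¹ * (r * u.2.2)) : R3)
      = (ρ⁻¹ * u.1, u.2.1, u.2.2) := by
    refine Prod.ext ?_ (Prod.ext ?_ ?_) <;> simp only <;> field_simp
  simp only [ew, neg_zero, zero_mul, Real.exp_zero, mul_one, add_zero, pow_one] at h
  rw [rescaledKernel, norm_mul, Complex.norm_real, Real.norm_of_nonneg (by positivity)]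
  calc _ ≤ r ^ 3 * ((2 * Real.pi) ^ 3)⁻¹ * (D * (r ^ 3)⁻¹ * ρ⁻¹ * (ρ ^ 2 * weight u)) := by
        refine mul_le_mul_of_nonneg_left (h.trans ?_) (by positivity)
        exact mul_le_mul_of_nonneg_left hw (by positivity)
    _ = ((2 * Real.pi) ^ 3)⁻¹ * D * ρ * weight u := by field_simp
    _ ≤ _ := by
      have := weight_nonneg u
      gcongr

/-- The mass is the Fourier amplitude at zero frequency, where only -κt survives in the exponent. -/
lemma integral_rescaledKernel {A κ t : ℝ} (hκ : 1 / 16 < κ) (ht : 0 < t)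
    (hi : Integrable (rescaledKernel A κ t)) :
    ∫ u, rescaledKernel A κ t u = Real.exp (-κ * t) := by
  have hr := timeScale_pos ht
  have hF := gaussDecay_greenHat₂ (A := A) hκ ht
  have hF' : Integrable (oscInt fun k => (greenHat₂ A κ t k : ℂ)) := by
    have h1 := (hi.const_mul ((timeScale t ^ 3 * ((2 * Real.pi) ^ 3)⁻¹ : ℝ) : ℂ)⁻¹).comp_smul
      (inv_ne_zero hr.ne')
    refine h1.congr (Eventually.of_forall fun w => ?_)
    have hc : ((timeScale t ^ 3 * ((2 * Real.pi) ^ 3)⁻¹ : ℝ) : ℂ) ≠ 0 := by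
      exact_mod_cast (by positivity : (0 : ℝ) < _).ne'
    simp only [rescaledKernel, Prod.smul_fst, Prod.smul_snd, smul_eq_mul,
      mul_inv_cancel_left₀ hr.ne', Prod.mk.eta, inv_mul_cancel_left₀ hc]
  have h0 : (greenHat₂ A κ t 0 : ℂ) = Real.exp (-κ * t) := by
    rw [greenHat₂_eq]
    congr 2
    simp [greenExponent]
  rw [← h0, ← integral_oscInt hF hF']
  simp only [rescaledKernel]
  rw [integral_const_mul, integral_comp_diag hr hr hr, ← mul_assoc, ← Complex.ofReal_mul]
  congr 2
  field_simp

lemma integral_greenFunction_mul {A κ t : ℝ} (hκ : 1 / 16 < κ) (ht : 0 < t) (P' : R3)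
    (f : R3 → ℂ) :
    ∫ P : R3, greenFunction A κ t P P' * f P
      = ∫ u : R3, rescaledKernel A κ t u
          * f ((timeScale t * u.1, timeScale t * u.2.1, timeScale t * u.2.2)
            + (P'.1 + A * t * P'.2.1, P'.2.1, P'.2.2)) := by
  have hr := timeScale_pos ht
  set q : R3 := (P'.1 + A * t * P'.2.1, P'.2.1, P'.2.2) with hq
  rw [← integral_add_right_eq_self _ q]
  have e : ∀ P : R3, greenFunction A κ t (P + q) P' = (((2 * Real.pi) ^ 3)⁻¹ : ℝ)
      * oscInt (fun k => (greenHat₂ A κ t k : ℂ)) P := fun P => by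
    rw [greenFunction_eq_oscInt hκ ht]
    congr 2
    refine Prod.ext ?_ (Prod.ext ?_ ?_) <;> simp only [relPos, hq, Prod.fst_add, Prod.snd_add] <;> ring
  simp only [e, rescaledKernel]
  have h := integral_comp_diag hr hr hr (fun w => ((timeScale t ^ 3 * ((2 * Real.pi) ^ 3)⁻¹ : ℝ) : ℂ)
    * oscInt (fun k => (greenHat₂ A κ t k : ℂ)) w * f (w + q))
  rw [h, ← integral_const_mul]
  refine integral_congr_ae (Eventually.of_forall fun w => ?_)
  simp only
  rw [← mul_assoc, ← mul_assoc, ← Complex.ofReal_mul]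
  congr 3
  field_simp

lemma tendsto_timeScale : Tendsto timeScale (𝓝[>] 0) (𝓝 0) := by
  have h : ContinuousAt timeScale 0 :=
    Real.continuousAt_rpow_const _ _ (Or.inr (by norm_num))
  have h0 : timeScale 0 = 0 := Real.zero_rpow (by norm_num)
  have := h.tendsto
  rw [h0] at this
  exact this.mono_left nhdsWithin_le_nhds

lemma tendsto_integral_greenFunction {A κ : ℝ} (hκ : 1 / 16 < κ) (hA : 0 < A) (P' : R3)
    (f : BoundedContinuousFunction R3 ℂ) :
    Tendsto (fun t : ℝ => ∫ P : R3, greenFunction A κ t P P' * f P) (𝓝[>] 0) (𝓝 (f P')) := by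
  obtain ⟨D, hD, hb⟩ := exists_norm_rescaledKernel_le hκ hA
  set x : ℝ → R3 → R3 := fun t u => (timeScale t * u.1, timeScale t * u.2.1, timeScale t * u.2.2)
    + (P'.1 + A * t * P'.2.1, P'.2.1, P'.2.2) with hx
  have ev : ∀ᶠ t : ℝ in 𝓝[>] 0, 0 < t ∧ A * t ≤ 1 := by
    have h1 : ∀ᶠ t : ℝ in 𝓝[>] 0, t < A⁻¹ :=
      nhdsWithin_le_nhds (gt_mem_nhds (inv_pos.2 hA))
    filter_upwards [self_mem_nhdsWithin, h1] with t ht ht1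
    refine ⟨ht, ?_⟩
    calc A * t ≤ A * A⁻¹ := by gcongr
      _ = 1 := mul_inv_cancel₀ hA.ne'
  have hint : ∀ t, 0 < t → A * t ≤ 1 → Integrable (rescaledKernel A κ t) := fun t ht hAt =>
    (integrable_weight.const_mul D).mono'
      (continuous_rescaledKernel hκ ht).aestronglyMeasurable (Eventually.of_forall (hb t ht hAt))
  have hxc : ∀ t, Continuous (x t) := fun t => by fun_prop
  -- Subtracting f(P') isolates the mass e^{-κt}, which tends to 1; the remaining integrand tends to
  -- 0 pointwise because the rescaled argument of f tends to P'.
  have split : ∀ᶠ t : ℝ in 𝓝[>] 0, ∫ P : R3, greenFunction A κ t P P' * f P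
      = (∫ u, rescaledKernel A κ t u * (f (x t u) - f P')) + Real.exp (-κ * t) * f P' := by
    filter_upwards [ev] with t ⟨ht, hAt⟩
    have hi := hint t ht hAt
    rw [integral_greenFunction_mul hκ ht, ← integral_rescaledKernel hκ ht hi,
      ← integral_mul_const, ← integral_add ?_ (hi.mul_const _)]
    · refine integral_congr_ae (Eventually.of_forall fun u => ?_)
      simp only [hx]; ring
    · refine hi.mul_bdd (c := ‖f‖ + ‖f‖)
        (((f.continuous.comp (hxc t)).sub continuous_const).aestronglyMeasurable)
        (Eventually.of_forall fun u => ?_)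
      exact (norm_sub_le _ _).trans (add_le_add (f.norm_coe_le_norm _) (f.norm_coe_le_norm _))
  have lim₁ : Tendsto (fun t => ∫ u, rescaledKernel A κ t u * (f (x t u) - f P'))
      (𝓝[>] 0) (𝓝 0) := by
    have hz : ∫ _ : R3, (0 : ℂ) = 0 := integral_zero _ _
    rw [← hz]
    refine tendsto_integral_filter_of_dominated_convergence
      (fun u => D * weight u * (‖f‖ + ‖f‖)) ?_ ?_ ((integrable_weight.const_mul D).mul_const _) ?_
    · filter_upwards [ev] with t ⟨ht, _⟩
      exact ((continuous_rescaledKernel hκ ht).mul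
        ((f.continuous.comp (hxc t)).sub continuous_const)).aestronglyMeasurable
    · filter_upwards [ev] with t ⟨ht, hAt⟩
      refine Eventually.of_forall fun u => ?_
      rw [norm_mul]
      refine mul_le_mul (hb t ht hAt u) ((norm_sub_le _ _).trans (add_le_add
        (f.norm_coe_le_norm _) (f.norm_coe_le_norm _))) (norm_nonneg _) ?_
      exact mul_nonneg hD.le (weight_nonneg u)
    · refine Eventually.of_forall fun u => ?_
      have ht0 : Tendsto (fun t : ℝ => t) (𝓝[>] 0) (𝓝 0) := nhdsWithin_le_nhds
      have hxt : Tendsto (fun t => x t u) (𝓝[>] 0) (𝓝 P') := by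
        have h1 := tendsto_timeScale.mul_const u.1
        have h2 := tendsto_timeScale.mul_const u.2.1
        have h3 := tendsto_timeScale.mul_const u.2.2
        have h4 := (((ht0.const_mul A).mul_const P'.2.1).const_add P'.1).prodMk_nhds
          (tendsto_const_nhds (x := P'.2))
        have h5 := ((h1.prodMk_nhds (h2.prodMk_nhds h3)).add h4)
        convert h5 using 2
        refine Prod.ext ?_ (Prod.ext ?_ ?_) <;> simp
      have hf : Tendsto (fun t => ‖f (x t u) - f P'‖) (𝓝[>] 0) (𝓝 0) := by
        have := (((f.continuous.tendsto P').comp hxt).sub_const (f P')).norm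
        simpa using this
      refine squeeze_zero_norm' ?_ (by simpa using hf.const_mul (D * weight u))
      filter_upwards [ev] with t ⟨ht, hAt⟩
      rw [norm_mul]
      exact mul_le_mul_of_nonneg_right (hb t ht hAt u) (norm_nonneg _)
  have lim₂ : Tendsto (fun t : ℝ => (Real.exp (-κ * t) : ℂ) * f P') (𝓝[>] 0) (𝓝 (f P')) := by
    have hc : Continuous fun t : ℝ => ((Real.exp (-κ * t) : ℝ) : ℂ) * f P' := by fun_prop
    have := hc.tendsto 0
    simp only [mul_zero, Real.exp_zero, Complex.ofReal_one, one_mul] at this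
    exact this.mono_left nhdsWithin_le_nhds
  have := lim₁.add lim₂
  rw [zero_add] at this
  exact this.congr' (split.mono fun t h => h.symm)

theorem isFundamentalSolution_greenFunction {A κ : ℝ} (hκ : 1 / 16 < κ) (hA : 0 < A) :
    IsFundamentalSolution A κ (greenFunction A κ) where
  smooth _ ht := contDiff_greenFunction hκ ht
  equation t ht P P' := by
    rw [neg_spatialOp_greenFunction hκ ht]
    exact hasDerivAt_greenFunction hκ ht P P'
  initial P' f := tendsto_integral_greenFunction hκ hA P' f

end Flame

end

theorem theorem2p1 (ε κ : ℝ) (hε : 0 < ε) (hκ : 1 / 16 + ε < κ) :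
    (∀ A : ℝ, 0 < A → Flame.IsFundamentalSolution A κ (Flame.greenFunction A κ)) ∧
    ∃ C : ℝ, 0 < C ∧
      ∀ A : ℝ, 0 < A → ∀ k₁ k₂ k₃ : ℕ, k₁ + k₂ + k₃ ≤ 6 →
      ∀ p : ℝ≥0∞, 1 ≤ p → ∀ t : ℝ, 0 < t →
        Flame.kernelNorm p (fun P P' =>
            Flame.mixedDeriv k₁ k₂ k₃ (fun Q => Flame.greenFunction A κ t Q P') P)
          ≤ ENNReal.ofReal (Flame.decayBound C ε A t p k₁ (k₁ + k₂ + k₃)) ∧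
        Flame.kernelNorm p (fun P P' =>
            Flame.mixedDeriv k₁ k₂ k₃ (fun Q' => Flame.greenFunction A κ t P Q') P')
          ≤ ENNReal.ofReal (Flame.decayBound C ε A t p k₁ (k₁ + k₂ + k₃)) := by
  have hκ' : 1 / 16 < κ := by linarith
  refine ⟨fun A hA => Flame.isFundamentalSolution_greenFunction hκ' hA, ?_⟩
  obtain ⟨C, hC, h⟩ := Flame.exists_kernelNorm_le hε hκ
  exact ⟨C, hC, fun A _ => h A⟩
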